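/- Let $\alpha>-1$ be real, $\alpha\ne 0,1,2,\ldots$, let $n\ge 1$ be an integer, and put $w(t)=t^{\alpha}e^{-t}$. For $x>0$ let $$I^{\alpha}[f](x)=\frac1\pi\int_0^\infty \frac{f(t)w(t)}{t-x}\,dt$$ in the sense of the Cauchy principal value at $t=x$. Let $L_k^{\alpha}$ be the generalized Laguerre polynomials, let $x_1,\ldots,x_n$ be the zeros of $L_n^{\alpha}$, let $\Phi(a,c;x)=\sum_{k\ge0}\frac{(a)_k x^k}{(c)_k k!}$, and for $x>0$ let $$Q_n^{\alpha}(x)=\frac{\Gamma(\alpha)}{\pi}e^{-x}\Phi(-n-\alpha,1-\alpha;x)-\cot(\pi\alpha)\,x^{\alpha}e^{-x}L_n^{\alpha}(x),$$ $$\gamma_m=-\frac{x_m}{(n+\alpha)L_{n-1}^{\alpha}(x_m)},\qquad A_m=\frac{\Gamma(\alpha+n)\,x_m}{n!\,(n+\alpha)\,[L_{n-1}^{\alpha}(x_m)]^2}\quad\text{(the Christoffel coefficients)}.$$ For $x>0$ different from all $x_m$, let $R_n(x)=R_n[f](x)$ be the remainder in the quadrature formula $$I^{\alpha}[f](x)=\sum_{m=1}^n\gamma_m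 f(x_m)\frac{Q_n^{\alpha}(x)-Q_n^{\alpha}(x_m)}{x-x_m}+R_n(x).$$ **Corollary 6.2.** Let $\xi_j>0$ be a zero of $Q_n^{\alpha}$. Then the zeros $x_1,\ldots,x_n$ of $L_n^\alpha$ are $n$ distinct positive numbers, all different from $\xi_j$, and the following holds. (i) Let $f$ be Hölder continuous on every segment $[0,a]$, $a>0$, with $|f(x)|\le Ce^{\beta x}$ for all large $x$, where $C$ and $\beta<1$ are constants. Then the principal value $I^{\alpha}[f](\xi_j)$ exists and $$I^{\alpha}[f](\xi_j)=\frac1\pi\sum_{m=1}^n\frac{A_m f(x_m)}{x_m-\xi_j}+R_n(\xi_j).$$ Moreover, for every polynomial $M$ of degree at most $n-1$, with $r=f-M$, the principal value $I^{\alpha}[r](\xi_j)$ exists and $$R_n(\xi_j)=-\sum_{m=1}^n\frac{\gamma_m r(x_m)}{\xi_j-x_m}\bigl[Q_n^{\alpha}(\xi_j)-Q_n^{\alpha}(x_m)\bigr]+I^{\alpha}[r](\xi_j).$$ (ii) The formula is exact for every polynomial $f$ of degree at most $2n$: then $R_n(\xi_j)=0$, so that $$I^{\alpha}[f](\xi_j)=\frac1\pi\sum_{m=1}^n\frac{A_m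 f(x_m)}{x_m-\xi_j}.$$ -/

import Mathlib

open Filter Topology MeasureTheory
open scoped NNReal

noncomputable section

namespace LaguerreCauchy

/-- The generalized Laguerre polynomial
`L_n^α(x) = ∑_{k=0}^n (-1)^k (α+k+1)_{n-k} / ((n-k)! k!) x^k`,
where `(a)_j` is the rising factorial; for `α > -1` the coefficient is the familiar
`(-1)^k Γ(n+α+1) / (Γ(k+α+1) (n-k)! k!)`. -/
def laguerre (α : ℝ) (n : ℕ) : Polynomial ℝ :=
  ∑ k ∈ Finset.range (n + 1),
    Polynomial.monomial k
      ((-1 : ℝ) ^ k * (ascPochhammer ℝ (n - k)).eval (α + k + 1)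
        / ((n - k).factorial * k.factorial : ℝ))

/-- The confluent hypergeometric (Kummer) function
`Φ(a, c; x) = ∑_k (a)_k x^k / ((c)_k k!)` (an everywhere convergent series). -/
def kummer (a c x : ℝ) : ℝ :=
  ∑' k : ℕ, (ascPochhammer ℝ k).eval a * x ^ k
    / ((ascPochhammer ℝ k).eval c * (k.factorial : ℝ))

/-- The weight `w(t) = t^α e^{-t}`. -/
def weight (α t : ℝ) : ℝ := t ^ α * Real.exp (-t)

/-- The truncated integral
`(1/π) (∫_0^{x-ε} + ∫_{x+ε}^∞) f(t) w(t) / (t - x) dt`. -/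
def truncatedIntegral (α : ℝ) (f : ℝ → ℝ) (x ε : ℝ) : ℝ :=
  (1 / Real.pi) *
    ((∫ t in Set.Ioo 0 (x - ε), f t * weight α t / (t - x))
      + ∫ t in Set.Ioi (x + ε), f t * weight α t / (t - x))

/-- `v` is the value of the Cauchy principal value integral
`I^α[f](x) = (1/π) ∫_0^∞ f(t) w(t) / (t - x) dt`: outside each small symmetric neighbourhood
of `x` the integrand is integrable on `(0, ∞)`, and the truncated integrals tend to `v`. -/
def HasCauchyIntegral (α : ℝ) (f : ℝ → ℝ) (x v : ℝ) : Prop :=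
  (∀ᶠ ε in 𝓝[>] (0 : ℝ),
      IntegrableOn (fun t => f t * weight α t / (t - x)) (Set.Ioo 0 (x - ε)) ∧
      IntegrableOn (fun t => f t * weight α t / (t - x)) (Set.Ioi (x + ε))) ∧
    Tendsto (truncatedIntegral α f x) (𝓝[>] 0) (𝓝 v)

/-- The Cauchy principal value integral `I^α[f](x)`; meaningful when
`HasCauchyIntegral α f x v` holds for some `v`, and then equal to `v`. -/
def cauchyIntegral (α : ℝ) (f : ℝ → ℝ) (x : ℝ) : ℝ :=
  limUnder (𝓝[>] (0 : ℝ)) (truncatedIntegral α f x)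

/-- The function
`Q_n^α(x) = (Γ(α)/π) e^{-x} Φ(-n-α, 1-α; x) - cot(πα) x^α e^{-x} L_n^α(x)`. -/
def Q (α : ℝ) (n : ℕ) (x : ℝ) : ℝ :=
  Real.Gamma α / Real.pi * Real.exp (-x) * kummer (-n - α) (1 - α) x
    - Real.cot (Real.pi * α) * x ^ α * Real.exp (-x) * (laguerre α n).eval x

/-- The nodes: the zeros of `L_n^α`. -/
def nodes (α : ℝ) (n : ℕ) : Finset ℝ := (laguerre α n).roots.toFinset

/-- `γ = - x / ((n + α) L_{n-1}^α(x))` at a node `x` (for `n ≥ 1`). -/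
def gammaCoeff (α : ℝ) (n : ℕ) (x : ℝ) : ℝ :=
  -x / ((n + α) * (laguerre α (n - 1)).eval x)

/-- The Christoffel coefficient
`A = Γ(α + n) x / (n! (n + α) [L_{n-1}^α(x)]^2)` at a node `x` (for `n ≥ 1`). -/
def christoffel (α : ℝ) (n : ℕ) (x : ℝ) : ℝ :=
  Real.Gamma (α + n) * x
    / ((n.factorial : ℝ) * (n + α) * (laguerre α (n - 1)).eval x ^ 2)

/-- The sum of the general quadrature formula,
`∑_m γ_m f(x_m) (Q_n^α(x) - Q_n^α(x_m)) / (x - x_m)`, for `x` not a node. -/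
def quadSum (α : ℝ) (n : ℕ) (f : ℝ → ℝ) (x : ℝ) : ℝ :=
  ∑ y ∈ nodes α n, gammaCoeff α n y * f y * ((Q α n x - Q α n y) / (x - y))

/-- The remainder `R_n(x)` of the general quadrature formula for `f`:
`I^α[f](x) = ∑_m γ_m f(x_m) (Q_n^α(x) - Q_n^α(x_m)) / (x - x_m) + R_n(x)`. -/
def remainder (α : ℝ) (n : ℕ) (f : ℝ → ℝ) (x : ℝ) : ℝ :=
  cauchyIntegral α f x - quadSum α n f x

/-- The class of densities: `f` is Hölder continuous on every segment `[0, a]`, and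
`|f(x)| ≤ C e^{βx}` for all large `x`, with some constants `C` and `β < 1`. -/
structure Admissible (f : ℝ → ℝ) : Prop where
  holder : ∀ a : ℝ, 0 < a → ∃ C r : ℝ≥0, 0 < r ∧ HolderOnWith C r f (Set.Icc 0 a)
  growth : ∃ C β : ℝ, β < 1 ∧ ∀ᶠ x in atTop, |f x| ≤ C * Real.exp (β * x)

end LaguerreCauchy

end

noncomputable section

namespace LaguerreCauchy

open Set

/-! The function π·`Q α n` is the principal value Cauchy transform of `laguerre α n` times the
weight (`hasPV_laguerre`). At a zero ξ of `Q α n` this transform vanishes, which buys one degree of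
exactness beyond Gauss quadrature.

Write L for the Laguerre polynomial of degree n, a for a node and q_a = L/(X - a). Since L = (X - ξ)
q_a + (ξ - a) q_a, the vanishing transform of L reduces the transform of q_a at ξ to the ordinary
integral ∫ q_a w. The same integral is the transform of L at a, namely π Q(a). Interpolating the
constant 1 by the q_a then gives the transform of the weight at ξ as ∑ A_a/(a - ξ)
(`pi_mul_Q_zero_eq_sum`). A polynomial p of degree at most 2n is p(ξ) + (X - ξ) q with deg q ≤ 2n -
1; the constant is covered by that sum and ∫ q w by `gauss_quadrature`, so the formula is exact for
p (`hasPV_polynomial`). The remainder formula for general f follows by linearity, as polynomials M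
of degree at most n - 1 leave no remainder.

The analytic input is the transform of the weight. For -1 < α < 0, scaling and splitting the
exponential reduce it to a Mellin kernel with value π cot(πb), b = -α, and an incomplete gamma
integral, which is a Kummer series. Multiplying the weight by t raises α by one. The transform then
passes to higher n because `Q` and the Laguerre polynomials obey the same three-term recurrence.
Existence for admissible f comes from subtracting a multiple of an indicator symmetric about the
singularity. -/

/-- `v` is the value of the principal value integral `∫_0^∞ g(t) / (t - x) dt`. -/
def HasPV (g : ℝ → ℝ) (x v : ℝ) : Prop :=
  (∀ᶠ ε in 𝓝[>] (0 : ℝ),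
      IntegrableOn (fun t => g t / (t - x)) (Ioo 0 (x - ε)) ∧
      IntegrableOn (fun t => g t / (t - x)) (Ioi (x + ε))) ∧
    Tendsto (fun ε => (∫ t in Ioo 0 (x - ε), g t / (t - x)) + ∫ t in Ioi (x + ε), g t / (t - x))
      (𝓝[>] 0) (𝓝 v)

/-! ### Calculus of principal values -/

lemma hasCauchyIntegral_of_hasPV {α : ℝ} {f : ℝ → ℝ} {x v : ℝ}
    (h : HasPV (fun t => f t * weight α t) x v) :
    HasCauchyIntegral α f x (1 / Real.pi * v) :=
  ⟨h.1, h.2.const_mul _⟩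

lemma HasCauchyIntegral.hasPV {α : ℝ} {f : ℝ → ℝ} {x v : ℝ}
    (h : HasCauchyIntegral α f x v) :
    HasPV (fun t => f t * weight α t) x (Real.pi * v) := by
  refine ⟨h.1, ?_⟩
  have := h.2.const_mul Real.pi
  refine this.congr fun ε => ?_
  unfold truncatedIntegral
  rw [← mul_assoc, mul_one_div_cancel Real.pi_ne_zero, one_mul]

lemma HasCauchyIntegral.cauchyIntegral_eq {α : ℝ} {f : ℝ → ℝ} {x v : ℝ}
    (h : HasCauchyIntegral α f x v) : cauchyIntegral α f x = v :=
  h.2.limUnder_eq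

lemma HasCauchyIntegral.self {α : ℝ} {f : ℝ → ℝ} {x v : ℝ}
    (h : HasCauchyIntegral α f x v) : HasCauchyIntegral α f x (cauchyIntegral α f x) := by
  rw [h.cauchyIntegral_eq]; exact h

lemma HasPV.unique {g : ℝ → ℝ} {x v w : ℝ} (h : HasPV g x v) (h' : HasPV g x w) : v = w :=
  tendsto_nhds_unique h.2 h'.2

lemma HasPV.congr {g g' : ℝ → ℝ} {x v : ℝ} (hx : 0 < x) (h : HasPV g x v)
    (hg : ∀ t, 0 < t → g t = g' t) : HasPV g' x v := by
  have h1 : ∀ ε, EqOn (fun t => g t / (t - x)) (fun t => g' t / (t - x)) (Ioo 0 (x - ε)) :=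
    fun ε t ht => by simp only [hg t ht.1]
  have h2 : ∀ ε > 0, EqOn (fun t => g t / (t - x)) (fun t => g' t / (t - x)) (Ioi (x + ε)) :=
    fun ε hε t ht => by
      have : 0 < t := lt_trans (by positivity) (mem_Ioi.1 ht)
      simp only [hg t this]
  refine ⟨?_, ?_⟩
  · filter_upwards [h.1, self_mem_nhdsWithin] with ε he hε
    exact ⟨he.1.congr_fun (h1 ε) measurableSet_Ioo, he.2.congr_fun (h2 ε hε) measurableSet_Ioi⟩
  · refine h.2.congr' ?_
    filter_upwards [self_mem_nhdsWithin] with ε hε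
    rw [setIntegral_congr_fun measurableSet_Ioo (h1 ε),
      setIntegral_congr_fun measurableSet_Ioi (h2 ε hε)]

lemma HasPV.add {g g' : ℝ → ℝ} {x v v' : ℝ} (h : HasPV g x v) (h' : HasPV g' x v') :
    HasPV (fun t => g t + g' t) x (v + v') := by
  have e : (fun t => (g t + g' t) / (t - x)) = (fun t => g t / (t - x) + g' t / (t - x)) := by
    funext t; rw [add_div]
  unfold HasPV
  rw [e]
  refine ⟨?_, ?_⟩
  · filter_upwards [h.1, h'.1] with ε h1 h2
    exact ⟨h1.1.add h2.1, h1.2.add h2.2⟩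
  · refine (h.2.add h'.2).congr' ?_
    filter_upwards [h.1, h'.1] with ε h1 h2
    rw [integral_add h1.1 h2.1, integral_add h1.2 h2.2]
    ring

lemma HasPV.const_mul {g : ℝ → ℝ} {x v : ℝ} (c : ℝ) (h : HasPV g x v) :
    HasPV (fun t => c * g t) x (c * v) := by
  have e : (fun t => (c * g t) / (t - x)) = (fun t => c * (g t / (t - x))) := by
    funext t; rw [mul_div_assoc]
  unfold HasPV
  rw [e]
  refine ⟨?_, ?_⟩
  · filter_upwards [h.1] with ε h1
    exact ⟨h1.1.const_mul c, h1.2.const_mul c⟩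
  · refine (h.2.const_mul c).congr fun ε => ?_
    simp only [integral_const_mul]
    ring

/-- No cancellation is needed when the quotient is integrable across `x`: dominated convergence
sends the truncated integrals to the full one. -/
lemma hasPV_of_integrableOn {g : ℝ → ℝ} {x : ℝ} (hx : 0 < x)
    (h : IntegrableOn (fun t => g t / (t - x)) (Ioi 0)) :
    HasPV g x (∫ t in Ioi 0, g t / (t - x)) := by
  have s1 : ∀ ε, Ioo 0 (x - ε) ⊆ Ioi 0 := fun ε t ht => ht.1
  have s2 : ∀ ε > 0, Ioi (x + ε) ⊆ Ioi 0 := fun ε hε t ht =>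
    lt_trans (by positivity) (mem_Ioi.1 ht)
  refine ⟨?_, ?_⟩
  · filter_upwards [self_mem_nhdsWithin] with ε hε
    exact ⟨h.mono_set (s1 ε), h.mono_set (s2 ε hε)⟩
  have key : Tendsto (fun ε => ∫ t in Ioi 0,
      (Ioo 0 (x - ε) ∪ Ioi (x + ε)).indicator (fun t => g t / (t - x)) t) (𝓝[>] 0)
      (𝓝 (∫ t in Ioi 0, g t / (t - x))) := by
    refine tendsto_integral_filter_of_dominated_convergence (fun t => ‖g t / (t - x)‖) ?_ ?_
      h.norm ?_
    · filter_upwards with ε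
      exact h.aestronglyMeasurable.indicator (measurableSet_Ioo.union measurableSet_Ioi)
    · filter_upwards with ε
      filter_upwards with t
      exact norm_indicator_le_norm_self _ _
    · have hne : ∀ᵐ t ∂(volume.restrict (Ioi (0 : ℝ))), t ≠ x :=
        ae_restrict_of_ae (Measure.ae_ne volume x)
      filter_upwards [hne, ae_restrict_mem measurableSet_Ioi] with t ht ht0
      refine tendsto_const_nhds.congr' ?_
      have : ∀ᶠ ε in 𝓝[>] (0 : ℝ), ε < |t - x| :=
        mem_nhdsWithin_of_mem_nhds (Iio_mem_nhds (abs_pos.2 (sub_ne_zero.2 ht)))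
      filter_upwards [this] with ε he
      rw [indicator_of_mem]
      rcases lt_or_gt_of_ne ht with h1 | h1
      · left
        rw [abs_of_neg (by linarith)] at he
        exact ⟨ht0, by linarith⟩
      · right
        rw [abs_of_pos (by linarith)] at he
        show x + ε < t
        linarith
  refine key.congr' ?_
  filter_upwards [self_mem_nhdsWithin] with ε hε
  have hε : 0 < ε := hε
  rw [setIntegral_indicator (measurableSet_Ioo.union measurableSet_Ioi),
    inter_eq_right.2 (union_subset (s1 ε) (s2 ε hε)),
    setIntegral_union _ measurableSet_Ioi (h.mono_set (s1 ε)) (h.mono_set (s2 ε hε))]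
  rw [Set.disjoint_left]
  rintro t ⟨_, h1⟩ h2
  have h2 : x + ε < t := h2
  linarith

/-- The interval is symmetric about `x`, so the two logarithms log(ε/x) and log(x/ε) cancel. This is
the model singularity, subtracted below to make quotients integrable. -/
lemma hasPV_indicator {x : ℝ} (hx : 0 < x) :
    HasPV ((Ioo 0 (2 * x)).indicator 1) x 0 := by
  have e1 : ∀ ε, 0 < ε → EqOn (fun t => (t - x)⁻¹)
      (fun t => (Ioo 0 (2 * x)).indicator 1 t / (t - x)) (Ioo 0 (x - ε)) := by
    intro ε hε t ht
    have : t ∈ Ioo 0 (2 * x) := ⟨ht.1, by linarith [ht.2]⟩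
    simp [indicator_of_mem this]
  have e2 : ∀ ε, 0 < ε → EqOn ((Ioo (x + ε) (2 * x)).indicator fun t => (t - x)⁻¹)
      (fun t => (Ioo 0 (2 * x)).indicator 1 t / (t - x)) (Ioi (x + ε)) := by
    intro ε hε t ht
    have ht : x + ε < t := ht
    by_cases h : t < 2 * x
    · have h1 : t ∈ Ioo 0 (2 * x) := ⟨by linarith, h⟩
      have h2 : t ∈ Ioo (x + ε) (2 * x) := ⟨ht, h⟩
      simp [indicator_of_mem h1, indicator_of_mem h2]
    · have h1 : t ∉ Ioo 0 (2 * x) := fun h' => h h'.2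
      have h2 : t ∉ Ioo (x + ε) (2 * x) := fun h' => h h'.2
      simp [indicator_of_notMem h1, indicator_of_notMem h2]
  have hev : ∀ᶠ ε in 𝓝[>] (0 : ℝ), 0 < ε ∧ ε < x := by
    filter_upwards [self_mem_nhdsWithin, mem_nhdsWithin_of_mem_nhds (Iio_mem_nhds hx)]
      with ε h1 h2 using ⟨h1, h2⟩
  have i1 : ∀ ε, 0 < ε → ε < x →
      IntervalIntegrable (fun t : ℝ => (t - x)⁻¹) volume 0 (x - ε) := by
    intro ε hε hεx
    refine ContinuousOn.intervalIntegrable ?_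
    refine ContinuousOn.inv₀ (by fun_prop) fun t ht => ?_
    rw [uIcc_of_le (by linarith)] at ht
    have := ht.2
    exact ne_of_lt (by linarith)
  have i2 : ∀ ε, 0 < ε → ε < x →
      IntervalIntegrable (fun t : ℝ => (t - x)⁻¹) volume (x + ε) (2 * x) := by
    intro ε hε hεx
    refine ContinuousOn.intervalIntegrable ?_
    refine ContinuousOn.inv₀ (by fun_prop) fun t ht => ?_
    rw [uIcc_of_le (by linarith)] at ht
    have := ht.1
    exact ne_of_gt (by linarith)
  have j2 : ∀ ε, 0 < ε → ε < x →
      IntegrableOn (fun t : ℝ => (t - x)⁻¹) (Ioo (x + ε) (2 * x)) := fun ε hε hεx =>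
    ((intervalIntegrable_iff_integrableOn_Ioo_of_le (by linarith)).1 (i2 ε hε hεx))
  refine ⟨?_, ?_⟩
  · filter_upwards [hev] with ε ⟨hε, hεx⟩
    constructor
    · refine IntegrableOn.congr_fun ?_ (e1 ε hε) measurableSet_Ioo
      exact ((intervalIntegrable_iff_integrableOn_Ioo_of_le (by linarith)).1 (i1 ε hε hεx))
    · refine IntegrableOn.congr_fun ?_ (e2 ε hε) measurableSet_Ioi
      exact ((integrable_indicator_iff measurableSet_Ioo).2 (j2 ε hε hεx)).integrableOn
  · refine tendsto_const_nhds.congr' ?_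
    filter_upwards [hev] with ε ⟨hε, hεx⟩
    rw [← setIntegral_congr_fun measurableSet_Ioo (e1 ε hε),
      ← setIntegral_congr_fun measurableSet_Ioi (e2 ε hε),
      setIntegral_indicator measurableSet_Ioo,
      inter_eq_right.2 (fun t ht => ht.1), ← integral_Ioc_eq_integral_Ioo,
      ← integral_Ioc_eq_integral_Ioo, ← intervalIntegral.integral_of_le (by linarith),
      ← intervalIntegral.integral_of_le (by linarith),
      intervalIntegral.integral_comp_sub_right (fun t => t⁻¹),
      intervalIntegral.integral_comp_sub_right (fun t => t⁻¹),
      integral_inv_of_neg (by linarith) (by linarith),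
      integral_inv_of_pos (by linarith) (by linarith)]
    rw [show (x - ε - x) / (0 - x) = ε / x by rw [← neg_div_neg_eq]; ring_nf,
      show (2 * x - x) / (x + ε - x) = (ε / x)⁻¹ by rw [inv_div]; ring_nf, Real.log_inv]
    ring

lemma hasPV_of_integrableOn_sub {g : ℝ → ℝ} {x : ℝ} (c : ℝ) (hx : 0 < x)
    (h : IntegrableOn (fun t => (g t - c * (Ioo 0 (2 * x)).indicator 1 t) / (t - x)) (Ioi 0)) :
    HasPV g x (∫ t in Ioi 0, (g t - c * (Ioo 0 (2 * x)).indicator 1 t) / (t - x)) := by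
  have := (hasPV_of_integrableOn hx h).add ((hasPV_indicator hx).const_mul c)
  rw [mul_zero, add_zero] at this
  exact this.congr hx fun t _ => by ring

/-- An integrable function satisfying a Hölder condition at `x` has a principal value:
after subtracting a multiple of the indicator function of `(0, 2x)` the quotient is integrable. -/
lemma integrableOn_quotient_of_holder {g : ℝ → ℝ} {x r C D : ℝ} (hx : 0 < x) (hr : 0 < r)
    (hi : IntegrableOn g (Ioi 0))
    (hh : ∀ t ∈ Ioo (x / 2) (3 * x / 2), |g t - g x| ≤ C * |t - x| ^ r + D * |t - x|) :
    IntegrableOn (fun t => (g t - g x * (Ioo 0 (2 * x)).indicator 1 t) / (t - x)) (Ioi 0) := by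
  set k : ℝ → ℝ := fun t => g t - g x * (Ioo 0 (2 * x)).indicator 1 t with hk
  have hind : IntegrableOn ((Ioo 0 (2 * x)).indicator (1 : ℝ → ℝ)) (Ioi 0) := by
    refine ((integrable_indicator_iff measurableSet_Ioo).2 ?_).integrableOn
    exact integrableOn_const measure_Ioo_lt_top.ne
  have hki : IntegrableOn k (Ioi 0) := hi.sub (hind.const_mul _)
  have hqm : AEStronglyMeasurable (fun t => (t - x)⁻¹) (volume.restrict (Ioi 0)) :=
    (measurable_id.sub_const x).inv.aestronglyMeasurable
  -- Away from `x` the factor 1/(t - x) is at most 2/x in modulus.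
  have hfar : ∀ s ⊆ Ioi (0 : ℝ), MeasurableSet s → (∀ t ∈ s, x / 2 ≤ |t - x|) →
      IntegrableOn (fun t => k t / (t - x)) s := by
    intro s hs hsm hd
    simp only [div_eq_mul_inv]
    refine (hki.mono_set hs).mul_bdd (c := (x / 2)⁻¹) (hqm.mono_measure
      (Measure.restrict_mono hs le_rfl)) ?_
    filter_upwards [ae_restrict_mem hsm] with t ht
    rw [norm_inv, Real.norm_eq_abs]
    exact inv_anti₀ (by positivity) (hd t ht)
  -- Near `x` the quotient is dominated by C|t - x|^(r-1) + D, integrable because r - 1 > -1.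
  have hpow : IntegrableOn (fun t => |t - x| ^ (r - 1)) (Ioo (x / 2) (3 * x / 2)) := by
    have h0 : ∀ a : ℝ, 0 < a → IntervalIntegrable (fun t : ℝ => t ^ (r - 1)) volume 0 a :=
      fun a _ => intervalIntegral.intervalIntegrable_rpow' (by linarith)
    have hR : IntervalIntegrable (fun t => |t - x| ^ (r - 1)) volume x (3 * x / 2) := by
      have := (h0 (x / 2) (by positivity)).comp_sub_right x
      rw [zero_add, show x / 2 + x = 3 * x / 2 by ring] at this
      refine this.congr fun t ht => ?_
      rw [uIoc_of_le (by linarith)] at ht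
      rw [abs_of_pos (by linarith [ht.1])]
    have hL : IntervalIntegrable (fun t => |t - x| ^ (r - 1)) volume (x / 2) x := by
      have := ((h0 (x / 2) (by positivity)).comp_sub_left x).symm
      rw [sub_zero, show x - x / 2 = x / 2 by ring] at this
      refine this.congr fun t ht => ?_
      rw [uIoc_of_le (by linarith)] at ht
      rw [abs_of_nonpos (by linarith [ht.2]), neg_sub]
    exact (intervalIntegrable_iff_integrableOn_Ioo_of_le (by linarith)).1 (hL.trans hR)
  have hnear : IntegrableOn (fun t => k t / (t - x)) (Ioo (x / 2) (3 * x / 2)) := by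
    have hs : Ioo (x / 2) (3 * x / 2) ⊆ Ioi 0 := fun t ht => lt_trans (by positivity) ht.1
    have hb : IntegrableOn (fun t => C * |t - x| ^ (r - 1) + D) (Ioo (x / 2) (3 * x / 2)) :=
      (hpow.const_mul C).add (integrableOn_const (by simp))
    refine hb.mono' ?_ ?_
    · exact ((hki.aestronglyMeasurable.mul hqm).mono_measure (Measure.restrict_mono hs le_rfl))
    · filter_upwards [ae_restrict_mem measurableSet_Ioo,
        ae_restrict_of_ae (Measure.ae_ne volume x)] with t ht htx
      have ht2 : t ∈ Ioo 0 (2 * x) := ⟨hs ht, by linarith [ht.2]⟩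
      have hp : 0 < |t - x| := abs_pos.2 (sub_ne_zero.2 htx)
      simp only [hk, indicator_of_mem ht2, Pi.one_apply, mul_one, norm_div, Real.norm_eq_abs]
      rw [div_le_iff₀ hp, add_mul, mul_assoc, ← Real.rpow_add_one hp.ne', sub_add_cancel]
      exact hh t ht
  have h1 := hfar (Ioc 0 (x / 2)) (fun t ht => ht.1) measurableSet_Ioc fun t ht => by
    rw [abs_of_nonpos (by linarith [ht.2])]; linarith [ht.2]
  have h2 := hfar (Ici (3 * x / 2)) (fun t ht => lt_of_lt_of_le (by positivity) (mem_Ici.1 ht))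
    measurableSet_Ici fun t ht => by
      have : 3 * x / 2 ≤ t := ht
      rw [abs_of_nonneg (by linarith)]; linarith
  refine ((h1.union hnear).union h2).mono_set fun t ht => ?_
  have ht : 0 < t := ht
  rcases le_or_gt t (x / 2) with h | h
  · exact Or.inl (Or.inl ⟨ht, h⟩)
  · rcases lt_or_ge t (3 * x / 2) with h' | h'
    · exact Or.inl (Or.inr ⟨h, h'⟩)
    · exact Or.inr h'

/-! ### The weight and admissible densities -/

lemma integrableOn_weight {α : ℝ} (hα : -1 < α) : IntegrableOn (weight α) (Ioi 0) := by
  have := Real.GammaIntegral_convergent (s := α + 1) (by linarith)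
  refine this.congr_fun (fun t _ => ?_) measurableSet_Ioi
  simp only [weight, add_sub_cancel_right]
  ring

lemma integral_weight {α : ℝ} (hα : -1 < α) :
    ∫ t in Ioi 0, weight α t = Real.Gamma (α + 1) := by
  rw [Real.Gamma_eq_integral (by linarith)]
  refine setIntegral_congr_fun measurableSet_Ioi (fun t _ => ?_)
  simp only [weight, add_sub_cancel_right]
  ring

lemma weight_nonneg (α : ℝ) {t : ℝ} (ht : 0 ≤ t) : 0 ≤ weight α t := by
  unfold weight; positivity

lemma weight_pos (α : ℝ) {t : ℝ} (ht : 0 < t) : 0 < weight α t := by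
  unfold weight; positivity

lemma weight_add_natCast (α : ℝ) (k : ℕ) {t : ℝ} (ht : 0 < t) :
    weight (α + k) t = t ^ k * weight α t := by
  unfold weight
  rw [Real.rpow_add_natCast ht.ne']
  ring

/-- The weight may be singular at 0 but is C¹ on a compact interval around `x`; this supplies the
Lipschitz term in the Hölder estimate for f·w. -/
lemma weight_lipschitz (α : ℝ) {x : ℝ} (hx : 0 < x) :
    ∃ W D : ℝ, 0 ≤ D ∧ ∀ t ∈ Ioo (x / 2) (3 * x / 2),
      |weight α t| ≤ W ∧ |weight α t - weight α x| ≤ D * |t - x| := by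
  have hcd : ContDiffOn ℝ 1 (weight α) (Icc (x / 2) (3 * x / 2)) := by
    unfold weight
    refine ContDiffOn.mul (fun t ht => ?_) (by fun_prop)
    exact (Real.contDiffAt_rpow_const_of_ne
      (lt_of_lt_of_le (by positivity) ht.1).ne').contDiffWithinAt
  obtain ⟨K, hK⟩ := hcd.exists_lipschitzOnWith one_ne_zero (convex_Icc _ _) isCompact_Icc
  obtain ⟨W, hW⟩ := isCompact_Icc.exists_bound_of_continuousOn hcd.continuousOn
  refine ⟨W, K, K.2, fun t ht => ⟨hW t (Ioo_subset_Icc_self ht), ?_⟩⟩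
  exact hK.dist_le_mul t (Ioo_subset_Icc_self ht) x ⟨by linarith, by linarith⟩

lemma Admissible.continuousOn {f : ℝ → ℝ} (hf : Admissible f) : ContinuousOn f (Ioi 0) := by
  intro t ht
  have ht : 0 < t := ht
  obtain ⟨C, r, hr, h⟩ := hf.holder (2 * t) (by positivity)
  have := h.continuousOn hr
  exact ((this t ⟨ht.le, by linarith⟩).continuousAt
    (Icc_mem_nhds ht (by linarith))).continuousWithinAt

lemma continuousOn_weight (α : ℝ) : ContinuousOn (weight α) (Ioi 0) := by
  unfold weight
  refine ContinuousOn.mul (fun t ht => ?_) (by fun_prop)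
  exact (Real.continuousAt_rpow_const t α (Or.inl (ne_of_gt ht))).continuousWithinAt

lemma Admissible.integrableOn_mul_weight {f : ℝ → ℝ} (hf : Admissible f) {α : ℝ}
    (hα : -1 < α) : IntegrableOn (fun t => f t * weight α t) (Ioi 0) := by
  obtain ⟨C, β, hβ, hev⟩ := hf.growth
  obtain ⟨a, ha⟩ := eventually_atTop.1 hev
  set b := max a 1
  have hb : 0 < b := lt_of_lt_of_le one_pos (le_max_right _ _)
  have hm : AEStronglyMeasurable (fun t => f t * weight α t) (volume.restrict (Ioi 0)) :=
    (hf.continuousOn.mul (continuousOn_weight α)).aestronglyMeasurable measurableSet_Ioi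
  obtain ⟨C', r, hr, hH⟩ := hf.holder b hb
  obtain ⟨B, hB⟩ := isCompact_Icc.exists_bound_of_continuousOn (hH.continuousOn hr)
  have s1 : Ioc 0 b ⊆ Ioi 0 := fun t ht => ht.1
  have s2 : Ioi b ⊆ Ioi 0 := Ioi_subset_Ioi hb.le
  have h1 : IntegrableOn (fun t => f t * weight α t) (Ioc 0 b) := by
    refine (((integrableOn_weight hα).mono_set s1).const_mul B).mono'
      (hm.mono_measure (Measure.restrict_mono s1 le_rfl)) ?_
    filter_upwards [ae_restrict_mem measurableSet_Ioc] with t ht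
    rw [norm_mul, Real.norm_of_nonneg (weight_nonneg α ht.1.le)]
    exact mul_le_mul_of_nonneg_right (hB t ⟨ht.1.le, ht.2⟩) (weight_nonneg α ht.1.le)
  have h2 : IntegrableOn (fun t => f t * weight α t) (Ioi b) := by
    -- The tail is dominated by t^α e^{-(1-β)t}; this is where β < 1 enters.
    have hI := (integrableOn_rpow_mul_exp_neg_mul_rpow (p := 1) (s := α) (b := 1 - β) hα one_pos
      (by linarith)).const_mul C
    refine (IntegrableOn.mono_set hI s2).mono'
      (hm.mono_measure (Measure.restrict_mono s2 le_rfl)) ?_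
    filter_upwards [ae_restrict_mem measurableSet_Ioi] with t ht
    have ht' : 0 < t := s2 ht
    have h3 : |f t| ≤ C * Real.exp (β * t) := ha t ((le_max_left a 1).trans (le_of_lt ht))
    rw [norm_mul, Real.norm_of_nonneg (weight_nonneg α ht'.le)]
    refine (mul_le_mul_of_nonneg_right h3 (weight_nonneg α ht'.le)).trans_eq ?_
    rw [weight, Real.rpow_one, show -(1 - β) * t = β * t + -t by ring, Real.exp_add]
    ring
  rw [← Ioc_union_Ioi_eq_Ioi hb.le]
  exact h1.union h2

lemma Admissible.integrableOn_quotient {f : ℝ → ℝ} (hf : Admissible f) {α x : ℝ}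
    (hα : -1 < α) (hx : 0 < x) :
    IntegrableOn (fun t => (f t * weight α t - f x * weight α x *
      (Ioo 0 (2 * x)).indicator 1 t) / (t - x)) (Ioi 0) := by
  obtain ⟨C, r, hr, hH⟩ := hf.holder (2 * x) (by positivity)
  obtain ⟨W, D, hD, hW⟩ := weight_lipschitz α hx
  refine integrableOn_quotient_of_holder (g := fun t => f t * weight α t) (r := r)
    (C := C * W) (D := |f x| * D) hx hr (hf.integrableOn_mul_weight hα) fun t ht => ?_
  obtain ⟨h1, h2⟩ := hW t ht
  have h3 : |f t - f x| ≤ C * |t - x| ^ (r : ℝ) :=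
    hH.dist_le ⟨by linarith [ht.1], by linarith [ht.2]⟩ ⟨hx.le, by linarith⟩
  have e : f t * weight α t - f x * weight α x
      = (f t - f x) * weight α t + f x * (weight α t - weight α x) := by ring
  rw [e]
  refine (abs_add_le _ _).trans ?_
  rw [abs_mul, abs_mul]
  refine add_le_add ?_ ?_
  · rw [mul_right_comm]
    exact mul_le_mul h3 h1 (abs_nonneg _) (by positivity)
  · rw [mul_assoc]
    exact mul_le_mul_of_nonneg_left h2 (abs_nonneg _)

lemma Admissible.exists_hasCauchyIntegral {f : ℝ → ℝ} (hf : Admissible f) {α x : ℝ}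
    (hα : -1 < α) (hx : 0 < x) : ∃ v, HasCauchyIntegral α f x v :=
  ⟨_, hasCauchyIntegral_of_hasPV (hasPV_of_integrableOn_sub _ hx (hf.integrableOn_quotient hα hx))⟩

/-- With the constant density, the integrability result above applies to the weight itself. -/
lemma admissible_one : Admissible fun _ => 1 where
  holder a _ := ⟨0, 1, one_pos, fun x _ y _ => by simp⟩
  growth := ⟨1, 0, one_pos, by simp⟩

/-! ### The Mellin kernel and the cotangent -/

/-- This is the Mittag-Leffler expansion of the cotangent with the terms paired differently: the
symmetric partial sum exceeds this one by 1/(N + b), which tends to 0. -/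
lemma tendsto_sum_cot {b : ℝ} (hb : 0 < b) (hb1 : b < 1) :
    Tendsto (fun N : ℕ => ∑ k ∈ Finset.range N, (1 / (k + b) - 1 / (k + 1 - b))) atTop
      (𝓝 (Real.pi * Real.cot (Real.pi * b))) := by
  have hz : (b : ℂ) ∈ Complex.integerComplement := by
    rintro ⟨m, hm⟩
    have : (m : ℝ) = b := by exact_mod_cast hm
    have h0 : (0 : ℝ) < m := this ▸ hb
    have h1 : (m : ℝ) < 1 := this ▸ hb1
    have h0' : 0 < m := by exact_mod_cast h0
    have h1' : m < 1 := by exact_mod_cast h1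
    omega
  have h := (Complex.continuous_re.tendsto _).comp (tendsto_logDeriv_euler_cot_sub hz)
  have e1 : ((Real.pi : ℂ) * Complex.cot (Real.pi * b) - 1 / b).re
      = Real.pi * Real.cot (Real.pi * b) - 1 / b := by
    have : (Real.pi : ℂ) * Complex.cot (Real.pi * b) - 1 / b
      = ((Real.pi * Real.cot (Real.pi * b) - 1 / b : ℝ) : ℂ) := by push_cast; rfl
    rw [this, Complex.ofReal_re]
  rw [e1] at h
  have h2 : Tendsto (fun N : ℕ => 1 / ((N : ℝ) + b)) atTop (𝓝 0) := by
    simp only [one_div]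
    exact tendsto_inv_atTop_zero.comp
      (tendsto_atTop_add_const_right _ b tendsto_natCast_atTop_atTop)
  have h3 := (h.const_add (1 / b)).sub h2
  rw [sub_zero, add_sub_cancel] at h3
  refine h3.congr fun N => ?_
  have e2 : ∀ N : ℕ, (∑ j ∈ Finset.range N, cotTerm (b : ℂ) j)
      = ((∑ j ∈ Finset.range N, (1 / (b - (j + 1)) + 1 / (b + (j + 1))) : ℝ) : ℂ) := by
    intro N; push_cast; rfl
  simp only [Function.comp, e2, Complex.ofReal_re]
  induction N with
  | zero => simp
  | succ N ih =>
    rw [Finset.sum_range_succ, Finset.sum_range_succ, ← ih]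
    have : 1 / ((N : ℝ) + 1 - b) = - (1 / (b - (N + 1))) := by
      rw [← one_div_neg_eq_neg_one_div]; ring_nf
    rw [this]
    push_cast
    ring

lemma integral_pow_mul_rpow {p : ℝ} (hp : -1 < p) (k : ℕ) :
    IntegrableOn (fun v : ℝ => v ^ k * v ^ p) (Ioo 0 1) ∧
    ∫ v in Ioo (0 : ℝ) 1, v ^ k * v ^ p = 1 / (k + p + 1) := by
  have e : EqOn (fun v : ℝ => v ^ (p + k)) (fun v : ℝ => v ^ k * v ^ p) (Ioo 0 1) := by
    intro v hv
    simp only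
    rw [Real.rpow_add_natCast hv.1.ne', mul_comm]
  have hk : -1 < p + k := by have := k.cast_nonneg (α := ℝ); linarith
  constructor
  · refine IntegrableOn.congr_fun ?_ e measurableSet_Ioo
    exact (intervalIntegrable_iff_integrableOn_Ioo_of_le zero_le_one).1
      (intervalIntegral.intervalIntegrable_rpow' hk)
  · rw [← setIntegral_congr_fun measurableSet_Ioo e, ← integral_Ioc_eq_integral_Ioo,
      ← intervalIntegral.integral_of_le zero_le_one, integral_rpow (Or.inl hk), Real.one_rpow,
      Real.zero_rpow (by linarith), sub_zero]
    ring_nf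

/-- Expand 1/(1 - v) geometrically. With G the integrand, v^N G - v^(N+1) G is a difference of
powers whose integral is the N-th term of the cotangent series, and ∫ v^N G tends to 0. -/
lemma integral_rpow_sub_rpow_div {b : ℝ} (hb : 0 < b) (hb1 : b < 1)
    (hi : IntegrableOn (fun v : ℝ => (v ^ (b - 1) - v ^ (-b)) / (1 - v)) (Ioo 0 1)) :
    ∫ v in Ioo (0 : ℝ) 1, (v ^ (b - 1) - v ^ (-b)) / (1 - v)
      = Real.pi * Real.cot (Real.pi * b) := by
  set G : ℝ → ℝ := fun v => (v ^ (b - 1) - v ^ (-b)) / (1 - v) with hG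
  have hb' : -1 < b - 1 := by linarith
  have hb'' : -1 < -b := by linarith
  have hGk : ∀ N : ℕ, IntegrableOn (fun v => v ^ N * G v) (Ioo 0 1) := fun N => by
    refine Integrable.bdd_mul (c := 1) hi (by fun_prop) ?_
    filter_upwards [ae_restrict_mem measurableSet_Ioo] with v hv
    rw [norm_pow, Real.norm_of_nonneg hv.1.le]
    exact pow_le_one₀ hv.1.le hv.2.le
  have hlim : Tendsto (fun N : ℕ => ∫ v in Ioo (0 : ℝ) 1, v ^ N * G v) atTop (𝓝 0) := by
    have := tendsto_integral_of_dominated_convergence (μ := volume.restrict (Ioo (0 : ℝ) 1))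
      (F := fun (N : ℕ) v => v ^ N * G v) (f := fun _ => 0) (fun v => ‖G v‖)
      (fun N => (hGk N).aestronglyMeasurable) hi.norm ?_ ?_
    · simpa using this
    · intro N
      filter_upwards [ae_restrict_mem measurableSet_Ioo] with v hv
      rw [norm_mul, norm_pow, Real.norm_of_nonneg hv.1.le]
      exact mul_le_of_le_one_left (norm_nonneg _) (pow_le_one₀ hv.1.le hv.2.le)
    · filter_upwards [ae_restrict_mem measurableSet_Ioo] with v hv
      have := (tendsto_pow_atTop_nhds_zero_of_lt_one hv.1.le hv.2).mul_const (G v)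
      rwa [zero_mul] at this
  have hsum : ∀ N : ℕ, ∑ k ∈ Finset.range N, (1 / ((k : ℝ) + b) - 1 / (k + 1 - b))
      = (∫ v in Ioo (0 : ℝ) 1, G v) - ∫ v in Ioo (0 : ℝ) 1, v ^ N * G v := by
    intro N
    induction N with
    | zero => simp
    | succ N ih =>
      have h1 := integral_pow_mul_rpow hb' N
      have h2 := integral_pow_mul_rpow hb'' N
      have h3 : (∫ v in Ioo (0 : ℝ) 1, v ^ N * G v) - ∫ v in Ioo (0 : ℝ) 1, v ^ (N + 1) * G v
          = 1 / ((N : ℝ) + b) - 1 / (N + 1 - b) := by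
        rw [← integral_sub (hGk N) (hGk (N + 1)),
          show (N : ℝ) + b = N + (b - 1) + 1 by ring, show (N : ℝ) + 1 - b = N + -b + 1 by ring,
          ← h1.2, ← h2.2, ← integral_sub h1.1 h2.1]
        refine setIntegral_congr_fun measurableSet_Ioo fun v hv => ?_
        have : 1 - v ≠ 0 := by linarith [hv.2]
        simp only [hG]
        field_simp
        ring
      rw [Finset.sum_range_succ, ih, ← h3]
      ring
  refine tendsto_nhds_unique ?_ (tendsto_sum_cot hb hb1)
  simp only [hsum]
  simpa using hlim.const_sub (∫ v in Ioo (0 : ℝ) 1, G v)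

/-- Under u = 1/v the indicator of (0, 2) beyond 1 becomes that of v > 1/2. The two pieces of this
integral are log 2 and -log 2, so the subtracted indicator contributes nothing in
`integral_mellin_kernel`. -/
lemma integral_half_indicator :
    IntegrableOn (fun v : ℝ => (1 - v⁻¹ * (Ioi (1 / 2)).indicator 1 v) / (1 - v)) (Ioo 0 1) ∧
    ∫ v in Ioo (0 : ℝ) 1, (1 - v⁻¹ * (Ioi (1 / 2)).indicator 1 v) / (1 - v) = 0 := by
  set H : ℝ → ℝ := fun v => (1 - v⁻¹ * (Ioi (1 / 2)).indicator 1 v) / (1 - v) with hH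
  have hu : Ioo (0 : ℝ) 1 = Ioc 0 (1 / 2) ∪ Ioo (1 / 2) 1 :=
    (Ioc_union_Ioo_eq_Ioo (by norm_num) (by norm_num)).symm
  have e1 : EqOn (fun v : ℝ => (1 - v)⁻¹) H (Ioc 0 (1 / 2)) := fun v hv => by
    have : v ∉ Ioi (1 / 2 : ℝ) := not_lt.2 hv.2
    simp only [hH, indicator_of_notMem this]
    simp
  have e2 : EqOn (fun v : ℝ => -v⁻¹) H (Ioo (1 / 2) 1) := fun v hv => by
    have h : v ∈ Ioi (1 / 2 : ℝ) := hv.1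
    have h1 : v ≠ 0 := by linarith [hv.1]
    have h2 : 1 - v ≠ 0 := by linarith [hv.2]
    simp only [hH, indicator_of_mem h, Pi.one_apply]
    field_simp
    ring
  have i1 : IntervalIntegrable (fun v : ℝ => (1 - v)⁻¹) volume 0 (1 / 2) := by
    refine ContinuousOn.intervalIntegrable (ContinuousOn.inv₀ (by fun_prop) fun v hv => ?_)
    rw [uIcc_of_le (by norm_num)] at hv
    linarith [hv.2]
  have i2 : IntervalIntegrable (fun v : ℝ => -v⁻¹) volume (1 / 2) 1 := by
    refine ContinuousOn.intervalIntegrable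
      (ContinuousOn.neg (ContinuousOn.inv₀ (by fun_prop) fun v hv => ?_))
    rw [uIcc_of_le (by norm_num)] at hv
    linarith [hv.1]
  have j1 : IntegrableOn H (Ioc 0 (1 / 2)) :=
    IntegrableOn.congr_fun i1.1 e1 measurableSet_Ioc
  have j2 : IntegrableOn H (Ioo (1 / 2) 1) :=
    IntegrableOn.congr_fun ((intervalIntegrable_iff_integrableOn_Ioo_of_le (by norm_num)).1 i2)
      e2 measurableSet_Ioo
  refine ⟨hu ▸ j1.union j2, ?_⟩
  rw [hu, setIntegral_union _ measurableSet_Ioo j1 j2,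
    ← setIntegral_congr_fun measurableSet_Ioc e1, ← setIntegral_congr_fun measurableSet_Ioo e2,
    ← integral_Ioc_eq_integral_Ioo,
    ← intervalIntegral.integral_of_le (by norm_num),
    ← intervalIntegral.integral_of_le (by norm_num), intervalIntegral.integral_neg,
    intervalIntegral.integral_comp_sub_left (fun t => t⁻¹),
    integral_inv_of_pos (by norm_num) (by norm_num),
    integral_inv_of_pos (by norm_num) (by norm_num)]
  · norm_num
  · rw [Set.disjoint_left]
    intro v h1 h2
    exact absurd h1.2 (not_le.2 h2.1)

/-- Principal value of the Mellin kernel, `PV ∫_0^∞ u^{-b} / (u - 1) du = π cot(πb)`. -/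
lemma integral_mellin_kernel {b : ℝ} (hb : 0 < b) (hb1 : b < 1)
    (hi : IntegrableOn (fun u : ℝ => (u ^ (-b) - (Ioo 0 2).indicator 1 u) / (u - 1)) (Ioi 0)) :
    ∫ u in Ioi (0 : ℝ), (u ^ (-b) - (Ioo 0 2).indicator 1 u) / (u - 1)
      = Real.pi * Real.cot (Real.pi * b) := by
  set k : ℝ → ℝ := fun u => (u ^ (-b) - (Ioo 0 2).indicator 1 u) / (u - 1) with hk
  set k' : ℝ → ℝ := fun v => (v ^ (b - 1) - v⁻¹ * (Ioi (1 / 2)).indicator 1 v) / (1 - v) with hk'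
  set H : ℝ → ℝ := fun v => (1 - v⁻¹ * (Ioi (1 / 2)).indicator 1 v) / (1 - v) with hH
  have hu : Ioi (0 : ℝ) = Ioc 0 1 ∪ Ioi 1 := (Ioc_union_Ioi_eq_Ioi zero_le_one).symm
  have hi1 : IntegrableOn k (Ioo 0 1) := hi.mono_set fun t ht => ht.1
  have hi2 : IntegrableOn k (Ioi 1) := hi.mono_set (Ioi_subset_Ioi zero_le_one)
  -- The part over (1, ∞) is folded onto (0, 1) by u = 1/v, with Jacobian v^(-2).
  have hinv : ∀ v ∈ Ioi (0 : ℝ),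
      (|(-1 : ℝ)| * v ^ ((-1 : ℝ) - 1)) • (Ioi 1).indicator k (v ^ (-1 : ℝ))
        = (Ioo 0 1).indicator k' v := by
    intro v hv
    have hv : 0 < v := hv
    rw [Real.rpow_neg_one]
    by_cases h : v < 1
    · have h1 : v⁻¹ ∈ Ioi (1 : ℝ) := (one_lt_inv₀ hv).2 h
      have h2 : v ∈ Ioo (0 : ℝ) 1 := ⟨hv, h⟩
      rw [indicator_of_mem h1, indicator_of_mem h2]
      have hind : (Ioo (0 : ℝ) 2).indicator (1 : ℝ → ℝ) v⁻¹ = (Ioi (1 / 2)).indicator 1 v := by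
        have : v⁻¹ ∈ Ioo (0 : ℝ) 2 ↔ v ∈ Ioi (1 / 2 : ℝ) := by
          rw [mem_Ioi, one_div, inv_lt_comm₀ two_pos hv]
          exact ⟨fun h => h.2, fun h => ⟨inv_pos.2 hv, h⟩⟩
        simp only [indicator_apply, this, Pi.one_apply]
      simp only [hk, hk', hind, smul_eq_mul]
      have hp : v ^ ((-1 : ℝ) - 1) = (v ^ 2)⁻¹ := by
        rw [show (-1 : ℝ) - 1 = -((2 : ℕ) : ℝ) by norm_num, Real.rpow_neg hv.le, Real.rpow_natCast]
      rw [hp, Real.inv_rpow hv.le, Real.rpow_neg hv.le b, inv_inv, Real.rpow_sub_one hv.ne']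
      have h4 : 1 - v ≠ 0 := by linarith
      have h5 : v⁻¹ - 1 ≠ 0 := by
        have : (1 : ℝ) < v⁻¹ := h1
        linarith
      have h6 : v⁻¹ - 1 = (1 - v) / v := by field_simp
      rw [h6]
      simp only [abs_neg, abs_one, one_mul]
      field_simp
    · have h1 : v⁻¹ ∉ Ioi (1 : ℝ) := fun h' => h ((one_lt_inv₀ hv).1 h')
      have h2 : v ∉ Ioo (0 : ℝ) 1 := fun h' => h h'.2
      rw [indicator_of_notMem h1, indicator_of_notMem h2, smul_zero]
  have hsub : Ioo (0 : ℝ) 1 ⊆ Ioi 0 := fun t ht => ht.1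
  have hI2 : ∫ u in Ioi (1 : ℝ), k u = ∫ v in Ioo (0 : ℝ) 1, k' v := by
    have := integral_comp_rpow_Ioi ((Ioi 1).indicator k) (p := -1) (by norm_num)
    rw [setIntegral_congr_fun measurableSet_Ioi hinv, setIntegral_indicator measurableSet_Ioo,
      setIntegral_indicator measurableSet_Ioi, inter_eq_right.2 hsub,
      inter_eq_right.2 (Ioi_subset_Ioi zero_le_one)] at this
    exact this.symm
  have hk'i : IntegrableOn k' (Ioo 0 1) := by
    have := (integrableOn_Ioi_comp_rpow_iff ((Ioi 1).indicator k) (p := -1) (by norm_num)).2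
      ((integrable_indicator_iff measurableSet_Ioi).2 hi2).integrableOn
    have h := (this.congr_fun hinv measurableSet_Ioi).mono_set hsub
    exact h.congr_fun (fun v hv => indicator_of_mem hv _) measurableSet_Ioo
  have hHi : IntegrableOn H (Ioo 0 1) := integral_half_indicator.1
  have hH0 : ∫ v in Ioo (0 : ℝ) 1, H v = 0 := integral_half_indicator.2
  have hadd : IntegrableOn (fun v => k v + k' v) (Ioo 0 1) := hi1.add hk'i
  have hG : EqOn (fun v => k v + k' v - H v) (fun v => (v ^ (b - 1) - v ^ (-b)) / (1 - v))
      (Ioo 0 1) := by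
    intro v hv
    have h1 : v ∈ Ioo (0 : ℝ) 2 := ⟨hv.1, by linarith [hv.2]⟩
    have h2 : v - 1 = -(1 - v) := by ring
    simp only [hk, hk', hH, indicator_of_mem h1, Pi.one_apply, h2, div_neg]
    ring
  have hGi := (hadd.sub hHi).congr_fun hG measurableSet_Ioo
  rw [← integral_rpow_sub_rpow_div hb hb1 hGi, ← setIntegral_congr_fun measurableSet_Ioo hG,
    integral_sub hadd hHi, integral_add hi1 hk'i, hH0, ← hI2, hu,
    setIntegral_union _ measurableSet_Ioi (hi.mono_set fun t ht => ht.1) hi2,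
    integral_Ioc_eq_integral_Ioo, sub_zero]
  rw [Set.disjoint_left]
  intro v h1 h2
  exact absurd h1.2 (not_le.2 h2)

/-- Write (e^{-x(u-1)} - 1)/(u - 1) as -∫_0^x e^{-s(u-1)} ds and swap the integrals, which is
legitimate as the integrand is positive; the inner integral in u is a gamma integral. -/
lemma integral_rpow_exp_difference {b x : ℝ} (hb : 0 < b) (hb1 : b < 1) (hx : 0 < x) :
    IntegrableOn (fun u : ℝ => u ^ (-b) * (Real.exp (-x * (u - 1)) - 1) / (u - 1)) (Ioi 0) ∧
    ∫ u in Ioi (0 : ℝ), u ^ (-b) * (Real.exp (-x * (u - 1)) - 1) / (u - 1)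
      = -(Real.Gamma (1 - b) * ∫ s in Ioc 0 x, Real.exp s * s ^ (b - 1)) := by
  set F : ℝ → ℝ → ℝ := fun u s => u ^ (-b) * Real.exp (-s * (u - 1)) with hF
  have hFm : Measurable (Function.uncurry F) := by
    have h1 : Measurable fun p : ℝ × ℝ => p.1 ^ (-b) := by fun_prop
    have h2 : Measurable fun p : ℝ × ℝ => Real.exp (-p.2 * (p.1 - 1)) := by fun_prop
    exact h1.mul h2
  have hsplit : ∀ s u : ℝ, F u s = Real.exp s * (u ^ (-b) * Real.exp (-(s * u))) := by
    intro s u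
    simp only [hF]
    rw [show -s * (u - 1) = s + -(s * u) by ring, Real.exp_add]
    ring
  have hFi : ∀ s, 0 < s → IntegrableOn (fun u => F u s) (Ioi 0) := by
    intro s hs
    simp only [hsplit]
    refine Integrable.const_mul ?_ _
    have := integrableOn_rpow_mul_exp_neg_mul_rpow (p := 1) (s := -b) (b := s) (by linarith)
      one_pos hs
    refine IntegrableOn.congr_fun this (fun u _ => ?_) measurableSet_Ioi
    simp only [Real.rpow_one, neg_mul]
  have hFint : ∀ s, 0 < s → ∫ u in Ioi (0 : ℝ), F u s
      = Real.Gamma (1 - b) * (Real.exp s * s ^ (b - 1)) := by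
    intro s hs
    simp only [hsplit]
    rw [integral_const_mul]
    have := Real.integral_rpow_mul_exp_neg_mul_Ioi (a := 1 - b) (by linarith) hs
    rw [show 1 - b - 1 = -b by ring] at this
    rw [this, one_div, Real.inv_rpow hs.le, ← Real.rpow_neg hs.le, neg_sub]
    ring
  have hint : Integrable (Function.uncurry F)
      ((volume.restrict (Ioi 0)).prod (volume.restrict (Ioc 0 x))) := by
    rw [integrable_prod_iff' hFm.aestronglyMeasurable]
    constructor
    · filter_upwards [ae_restrict_mem measurableSet_Ioc] with s hs
      exact hFi s hs.1
    · have : IntegrableOn (fun s => Real.Gamma (1 - b) * (Real.exp s * s ^ (b - 1)))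
          (Ioc 0 x) := by
        refine Integrable.const_mul ?_ _
        have h0 : IntervalIntegrable (fun s : ℝ => s ^ (b - 1)) volume 0 x :=
          intervalIntegral.intervalIntegrable_rpow' (by linarith)
        exact (h0.continuousOn_mul Real.continuous_exp.continuousOn).1
      refine IntegrableOn.congr_fun this (fun s hs => ?_) measurableSet_Ioc
      rw [← hFint s hs.1]
      refine setIntegral_congr_fun measurableSet_Ioi fun u hu => ?_
      have hu : 0 < u := hu
      simp only [Function.uncurry, hF]
      rw [Real.norm_of_nonneg (by positivity)]
  have hinner : (fun u => -∫ s in Ioc 0 x, F u s) =ᵐ[volume.restrict (Ioi 0)]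
      fun u : ℝ => u ^ (-b) * (Real.exp (-x * (u - 1)) - 1) / (u - 1) := by
    filter_upwards [ae_restrict_of_ae (Measure.ae_ne volume 1)] with u hu
    have hu : u - 1 ≠ 0 := sub_ne_zero.2 hu
    rw [integral_const_mul, ← intervalIntegral.integral_of_le hx.le]
    have h2 : ∫ s in (0 : ℝ)..x, Real.exp (-s * (u - 1))
        = (Real.exp (-x * (u - 1)) - 1) / (-(u - 1)) := by
      have hd : ∀ s ∈ uIcc 0 x, HasDerivAt (fun s => Real.exp (-s * (u - 1)) / (-(u - 1)))
          (Real.exp (-s * (u - 1))) s := by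
        intro s _
        have h0 : HasDerivAt (fun s : ℝ => -s * (u - 1)) (-1 * (u - 1)) s :=
          (hasDerivAt_neg s).mul_const _
        have h := h0.exp.div_const (-(u - 1))
        rwa [show Real.exp (-s * (u - 1)) * (-1 * (u - 1)) / -(u - 1)
          = Real.exp (-s * (u - 1)) by field_simp] at h
      rw [intervalIntegral.integral_eq_sub_of_hasDerivAt hd
        (Continuous.intervalIntegrable (by fun_prop) _ _)]
      simp
      ring
    rw [h2]
    field_simp
  refine ⟨(hint.integral_prod_left.neg).congr hinner, ?_⟩
  rw [← integral_congr_ae hinner, integral_neg, integral_integral_swap hint,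
    ← integral_const_mul]
  congr 1
  exact setIntegral_congr_fun measurableSet_Ioc fun s hs => hFint s hs.1

/-- Termwise integration of the exponential series, in the form to be matched with a Kummer series.
-/
lemma hasSum_integral_exp_mul_rpow {b x : ℝ} (hb : 0 < b) (hx : 0 < x) :
    HasSum (fun k : ℕ => x ^ b * (x ^ k / ((k + b) * k.factorial)))
      (∫ s in Ioc 0 x, Real.exp s * s ^ (b - 1)) := by
  have hterm : ∀ k : ℕ, IntegrableOn (fun s : ℝ => s ^ k / k.factorial * s ^ (b - 1)) (Ioc 0 x) ∧
      ∫ s in Ioc 0 x, s ^ k / k.factorial * s ^ (b - 1)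
        = x ^ b * (x ^ k / ((k + b) * k.factorial)) := by
    intro k
    have e : EqOn (fun s : ℝ => (k.factorial : ℝ)⁻¹ * s ^ (b - 1 + k))
        (fun s : ℝ => s ^ k / k.factorial * s ^ (b - 1)) (Ioc 0 x) := by
      intro s hs
      simp only
      rw [Real.rpow_add_natCast hs.1.ne']
      ring
    have hk : -1 < b - 1 + k := by have := k.cast_nonneg (α := ℝ); linarith
    have h0 : IntervalIntegrable (fun s : ℝ => s ^ (b - 1 + k)) volume 0 x :=
      intervalIntegral.intervalIntegrable_rpow' hk
    refine ⟨IntegrableOn.congr_fun (h0.1.const_mul _) e measurableSet_Ioc, ?_⟩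
    rw [← setIntegral_congr_fun measurableSet_Ioc e, integral_const_mul,
      ← intervalIntegral.integral_of_le hx.le, integral_rpow (Or.inl hk),
      Real.zero_rpow (by linarith), sub_zero, show b - 1 + k + 1 = b + k by ring,
      Real.rpow_add_natCast hx.ne', add_comm b]
    have h1 : (k : ℝ) + b ≠ 0 := by have := k.cast_nonneg (α := ℝ); linarith
    have h2 : (k.factorial : ℝ) ≠ 0 := by positivity
    field_simp
  have hsum : Summable fun k : ℕ => x ^ b * (x ^ k / ((k + b) * k.factorial)) := by
    refine Summable.mul_left _ ?_
    refine Summable.of_nonneg_of_le (fun k => by positivity) (fun k => ?_)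
      ((Real.summable_pow_div_factorial x).mul_left b⁻¹)
    rw [inv_mul_eq_div, div_div, mul_comm (k.factorial : ℝ) b]
    have := k.cast_nonneg (α := ℝ)
    gcongr
    linarith
  have h := hasSum_integral_of_summable_integral_norm (μ := volume.restrict (Ioc 0 x))
    (F := fun (k : ℕ) (s : ℝ) => s ^ k / k.factorial * s ^ (b - 1)) (fun k => (hterm k).1) ?_
  · simp only [(hterm _).2] at h
    have e : ∀ s : ℝ, ∑' k : ℕ, s ^ k / k.factorial * s ^ (b - 1)
        = Real.exp s * s ^ (b - 1) := fun s => by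
      rw [tsum_mul_right, Real.exp_eq_exp_ℝ, NormedSpace.exp_eq_tsum_div (𝔸 := ℝ)]
    simpa only [e] using h
  · refine hsum.congr fun k => ?_
    rw [← (hterm k).2]
    refine setIntegral_congr_fun measurableSet_Ioc fun s hs => ?_
    have hs : 0 < s := hs.1
    rw [Real.norm_of_nonneg (by positivity)]

lemma hasSum_congr_terms {f g : ℕ → ℝ} {a : ℝ} (h : HasSum f a) (e : ∀ k, g k = f k) :
    HasSum g a :=
  (funext e : g = f) ▸ h

/-- Substitute t = xu and split e^{-x(u-1)} as 1 plus the rest: the 1 yields the Mellin kernel, the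
rest the integral of `integral_rpow_exp_difference`. -/
lemma hasPV_weight_neg {b x : ℝ} (hb : 0 < b) (hb1 : b < 1) (hx : 0 < x) :
    HasPV (weight (-b)) x (weight (-b) x * (Real.pi * Real.cot (Real.pi * b)
      - Real.Gamma (1 - b) * ∫ s in Ioc 0 x, Real.exp s * s ^ (b - 1))) := by
  have hα : -1 < -b := by linarith
  have hN := admissible_one.integrableOn_quotient hα hx
  simp only [one_mul] at hN
  have hPV := hasPV_of_integrableOn_sub _ hx hN
  set N : ℝ → ℝ := fun t => (weight (-b) t - weight (-b) x *
      (Ioo 0 (2 * x)).indicator 1 t) / (t - x) with hNdef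
  set k : ℝ → ℝ := fun u => (u ^ (-b) - (Ioo 0 2).indicator 1 u) / (u - 1) with hk
  set E : ℝ → ℝ := fun u => u ^ (-b) * (Real.exp (-x * (u - 1)) - 1) / (u - 1) with hE
  have hw := weight_pos (-b) hx
  have hscale : ∀ u ∈ Ioi (0 : ℝ), x * N (x * u) = weight (-b) x * (E u + k u) := by
    intro u hu
    have hu : 0 < u := hu
    have hind : (Ioo 0 (2 * x)).indicator (1 : ℝ → ℝ) (x * u) = (Ioo 0 2).indicator 1 u := by
      have : x * u ∈ Ioo 0 (2 * x) ↔ u ∈ Ioo (0 : ℝ) 2 := by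
        rw [mem_Ioo, mem_Ioo, mul_comm x u, mul_lt_mul_iff_left₀ hx, mul_pos_iff_of_pos_right hx]
      simp only [indicator_apply, this, Pi.one_apply]
    have hwu : weight (-b) (x * u) = weight (-b) x * (u ^ (-b) * Real.exp (-x * (u - 1))) := by
      unfold weight
      rw [Real.mul_rpow hx.le hu.le, show -(x * u) = -x + -x * (u - 1) by ring, Real.exp_add]
      ring
    simp only [hNdef, hE, hk, hind, hwu]
    rw [show x * u - x = x * (u - 1) by ring, ← mul_div_assoc, mul_div_mul_left _ _ hx.ne']
    ring
  obtain ⟨hEi, hEv⟩ := integral_rpow_exp_difference hb hb1 hx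
  have hNs : IntegrableOn (fun u => x * N (x * u)) (Ioi 0) := by
    refine Integrable.const_mul ?_ x
    refine (integrableOn_Ioi_comp_mul_left_iff N 0 hx).2 ?_
    rwa [mul_zero]
  -- Integrability of the Mellin kernel is not proved directly: it is the difference of two
  -- functions already known to be integrable.
  have hki : IntegrableOn k (Ioi 0) := by
    have hsub : IntegrableOn (fun u => (weight (-b) x)⁻¹ * (x * N (x * u)) - E u) (Ioi 0) :=
      (hNs.const_mul (weight (-b) x)⁻¹).sub hEi
    refine hsub.congr_fun (fun u hu => ?_) measurableSet_Ioi
    simp only [hscale u hu]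
    rw [inv_mul_cancel_left₀ hw.ne', add_sub_cancel_left]
  have hval : ∫ t in Ioi 0, N t = weight (-b) x * (Real.pi * Real.cot (Real.pi * b)
      - Real.Gamma (1 - b) * ∫ s in Ioc 0 x, Real.exp s * s ^ (b - 1)) := by
    have h1 := integral_comp_mul_left_Ioi' N 0 hx
    rw [mul_zero, smul_eq_mul, ← integral_const_mul] at h1
    rw [← h1, setIntegral_congr_fun measurableSet_Ioi hscale, integral_const_mul,
      integral_add hEi hki, hEv, integral_mellin_kernel hb hb1 hki]
    ring
  rwa [hval] at hPV

/-! ### Kummer functions and the Cauchy transform of the weight -/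

lemma ascPochhammer_eval_mul_add (a : ℝ) (k : ℕ) :
    (ascPochhammer ℝ k).eval a * (a + k) = a * (ascPochhammer ℝ k).eval (a + 1) := by
  rw [← ascPochhammer_succ_eval, ascPochhammer_succ_left]
  simp

lemma ascPochhammer_eval_ne_zero {c : ℝ} (hc : ∀ k : ℕ, c + k ≠ 0) (k : ℕ) :
    (ascPochhammer ℝ k).eval c ≠ 0 := by
  induction k with
  | zero => simp
  | succ k ih => rw [ascPochhammer_succ_eval]; exact mul_ne_zero ih (hc k)

lemma summable_kummer {a c : ℝ} (hc : ∀ k : ℕ, c + k ≠ 0) (x : ℝ) :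
    Summable fun k : ℕ => (ascPochhammer ℝ k).eval a * x ^ k
      / ((ascPochhammer ℝ k).eval c * (k.factorial : ℝ)) := by
  have hlim : Tendsto (fun k : ℕ => (a + k) / (c + k) * (x / (k + 1))) atTop (𝓝 (1 * 0)) := by
    refine Tendsto.mul ?_ ?_
    · have h := tendsto_natCast_atTop_atTop (R := ℝ)
      have h1 : Tendsto (fun k : ℕ => (a - c) / (c + k)) atTop (𝓝 0) :=
        tendsto_const_nhds.div_atTop (tendsto_atTop_add_const_left _ c h)
      have h2 := h1.const_add 1
      rw [add_zero] at h2
      refine h2.congr fun k => ?_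
      have := hc k
      field_simp
      ring
    · exact tendsto_const_nhds.div_atTop
        (tendsto_atTop_add_const_right _ 1 tendsto_natCast_atTop_atTop)
  rw [mul_zero] at hlim
  have hev := hlim.norm.eventually (ge_mem_nhds (show ‖(0 : ℝ)‖ < 1 / 2 by norm_num))
  refine summable_of_ratio_norm_eventually_le (r := 1 / 2) (by norm_num) ?_
  filter_upwards [hev] with k hk
  refine le_trans (le_of_eq ?_) (mul_le_mul_of_nonneg_right hk (norm_nonneg _))
  rw [← norm_mul]
  congr 1
  have h1 := hc k
  have h2 := ascPochhammer_eval_ne_zero hc k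
  have h3 : (k.factorial : ℝ) ≠ 0 := by positivity
  have h4 : (k : ℝ) + 1 ≠ 0 := by positivity
  rw [ascPochhammer_succ_eval, ascPochhammer_succ_eval, Nat.factorial_succ]
  push_cast
  field_simp
  ring

/-- The Pochhammer quotient (a)_k/(a+1)_k telescopes to a/(a + k). -/
lemma hasSum_kummer_add_one {a : ℝ} (ha : ∀ k : ℕ, a + k ≠ 0) (x : ℝ) :
    HasSum (fun k : ℕ => a / (a + k) * (x ^ k / k.factorial)) (kummer a (a + 1) x) := by
  have ha' : ∀ k : ℕ, a + 1 + k ≠ 0 := fun k => by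
    have := ha (k + 1); push_cast at this; rwa [add_assoc, add_comm (1 : ℝ)]
  have h := (summable_kummer (a := a) ha' x).hasSum
  refine hasSum_congr_terms h fun k => ?_
  have h1 := ascPochhammer_eval_mul_add a k
  have h2 := ascPochhammer_eval_ne_zero ha' k
  have h3 : (k.factorial : ℝ) ≠ 0 := by positivity
  have h4 := ha k
  field_simp
  linear_combination -x ^ k * h1

/-- The series of (a+1)(e^x - Φ(a, a+1; x)) has coefficients (a+1)k/((a+k)k!), so its constant term
vanishes and an index shift gives x Φ(a+1, a+2; x). -/
lemma kummer_add_one_shift {a : ℝ} (ha : ∀ k : ℕ, a + k ≠ 0) (x : ℝ) :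
    (a + 1) * kummer a (a + 1) x = (a + 1) * Real.exp x - x * kummer (a + 1) (a + 2) x := by
  have ha' : ∀ k : ℕ, a + 1 + k ≠ 0 := fun k => by
    have := ha (k + 1); push_cast at this; rwa [add_assoc, add_comm (1 : ℝ)]
  have h1 := (hasSum_kummer_add_one ha x).mul_left (a + 1)
  have h2 : HasSum (fun k : ℕ => (a + 1) * (x ^ k / k.factorial)) ((a + 1) * Real.exp x) := by
    rw [Real.exp_eq_exp_ℝ]
    exact (NormedSpace.expSeries_div_hasSum_exp x).mul_left _
  have h3 := h2.sub h1
  rw [← hasSum_nat_add_iff' 1] at h3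
  have h4 := (hasSum_kummer_add_one ha' x).mul_left x
  rw [show a + 1 + 1 = a + 2 by ring] at h4
  have h5 : x * kummer (a + 1) (a + 2) x
      = (a + 1) * Real.exp x - (a + 1) * kummer a (a + 1) x := by
    have h0 := ha 0
    simp only [Nat.cast_zero, add_zero] at h0
    have e0 : ∑ i ∈ Finset.range 1, ((a + 1) * (x ^ i / (i.factorial : ℝ))
        - (a + 1) * (a / (a + i) * (x ^ i / i.factorial))) = 0 := by simp [div_self h0]
    rw [e0, sub_zero] at h3
    refine h4.unique (hasSum_congr_terms h3 fun k => ?_)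
    · have e1 := ha' k
      have e2 : a + (k + 1 : ℕ) ≠ 0 := ha (k + 1)
      push_cast at e2 ⊢
      have e3 : (k.factorial : ℝ) ≠ 0 := by positivity
      have e4 : (k : ℝ) + 1 ≠ 0 := by positivity
      rw [Nat.factorial_succ, show a + 1 + (k : ℝ) = a + (k + 1) by ring, pow_succ]
      push_cast
      field_simp
      ring
  linarith

lemma Q_zero (α x : ℝ) : Real.pi * Q α 0 x
    = Real.Gamma α * Real.exp (-x) * kummer (-α) (-α + 1) x
      - Real.pi * Real.cot (Real.pi * α) * weight α x := by
  have hl : (laguerre α 0).eval x = 1 := by simp [laguerre]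
  unfold Q weight
  rw [hl, Nat.cast_zero, neg_zero, zero_sub, show (1 : ℝ) - α = -α + 1 by ring]
  have := Real.pi_ne_zero
  field_simp

/-- The incomplete gamma series with b = -α agrees termwise with the Kummer series because Γ(α+1) =
αΓ(α); the cotangent term matches by oddness. -/
lemma hasPV_weight_of_neg {α x : ℝ} (hα : -1 < α) (hα0 : α < 0) (hx : 0 < x) :
    HasPV (weight α) x (Real.pi * Q α 0 x) := by
  have h := hasPV_weight_neg (b := -α) (by linarith) (by linarith) hx
  rw [neg_neg] at h
  have hne : ∀ k : ℕ, -α + k ≠ 0 := fun k => by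
    have := k.cast_nonneg (α := ℝ); linarith
  have h1 := (hasSum_integral_exp_mul_rpow (b := -α) (by linarith) hx).mul_left
    (Real.Gamma (α + 1) * weight α x)
  have h2 := (hasSum_kummer_add_one hne x).mul_left (Real.Gamma α * Real.exp (-x))
  have h3 : Real.Gamma α * Real.exp (-x) * kummer (-α) (-α + 1) x
      = -(Real.Gamma (α + 1) * weight α x *
        ∫ s in Ioc 0 x, Real.exp s * s ^ (-α - 1)) := by
    refine h2.unique (hasSum_congr_terms h1.neg fun k => ?_)
    have e1 := hne k
    have e2 : (k.factorial : ℝ) ≠ 0 := by positivity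
    have e3 : x ^ α * x ^ (-α) = 1 := by rw [← Real.rpow_add hx, add_neg_cancel, Real.rpow_zero]
    rw [Real.Gamma_add_one hα0.ne, weight, add_comm (k : ℝ)]
    rw [show α * Real.Gamma α * (x ^ α * Real.exp (-x)) * (x ^ (-α) *
        (x ^ k / ((-α + k) * k.factorial)))
      = α * Real.Gamma α * (x ^ α * x ^ (-α)) * Real.exp (-x) * (x ^ k / ((-α + k) * k.factorial))
        by ring, e3]
    field_simp
  rw [Q_zero, h3]
  convert h using 1
  have hcot : Real.cot (Real.pi * -α) = -Real.cot (Real.pi * α) := by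
    rw [mul_neg, Real.cot_eq_cos_div_sin, Real.cot_eq_cos_div_sin, Real.cos_neg, Real.sin_neg,
      div_neg]
  rw [hcot, show 1 - -α = α + 1 by ring]
  ring

/-- The counterpart for `Q` of t·w = x·w + (t - x)·w, whose last term has principal value ∫ w =
Γ(α+1). -/
lemma pi_mul_Q_zero_add_one {α x : ℝ} (hα : ∀ k : ℕ, α ≠ k) (hα1 : α + 1 ≠ 0) (hx : 0 < x) :
    Real.pi * Q (α + 1) 0 x = x * (Real.pi * Q α 0 x) + Real.Gamma (α + 1) := by
  have hα0 : α ≠ 0 := by simpa using hα 0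
  have hne : ∀ k : ℕ, -(α + 1) + k ≠ 0 := by
    intro k hk
    rcases k with _ | k
    · simp at hk
      exact hα1 (by linarith)
    · push_cast at hk
      exact hα k (by linarith)
  have h := kummer_add_one_shift hne x
  have hcot : Real.cot (Real.pi * (α + 1)) = Real.cot (Real.pi * α) := by
    rw [mul_add, mul_one, Real.cot_eq_cos_div_sin, Real.cot_eq_cos_div_sin, Real.cos_add_pi,
      Real.sin_add_pi, neg_div_neg_eq]
  have hw : weight (α + 1) x = x * weight α x := by
    simpa using weight_add_natCast α 1 hx
  have he : Real.exp (-x) * Real.exp x = 1 := by rw [← Real.exp_add]; simp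
  rw [show -(α + 1) + 1 = -α by ring, show -(α + 1) + 2 = -α + 1 by ring] at h
  rw [Q_zero, Q_zero, hcot, hw, Real.Gamma_add_one hα0, show -(α + 1) + 1 = -α by ring]
  linear_combination -Real.Gamma α * Real.exp (-x) * h + Real.Gamma α * α * he

/-- Induction on an integer above α, lowering α by one until it is negative. -/
lemma hasPV_weight {α x : ℝ} (hα : -1 < α) (hα' : ∀ k : ℕ, α ≠ k) (hx : 0 < x) :
    HasPV (weight α) x (Real.pi * Q α 0 x) := by
  have key : ∀ m : ℕ, ∀ α : ℝ, -1 < α → (∀ k : ℕ, α ≠ k) → α < m →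
      HasPV (weight α) x (Real.pi * Q α 0 x) := by
    intro m
    induction m with
    | zero => exact fun α h1 _ h2 => hasPV_weight_of_neg h1 (by simpa using h2) hx
    | succ m ih =>
      intro α h1 h2 h3
      rcases lt_or_ge α 0 with h0 | h0
      · exact hasPV_weight_of_neg h1 h0 hx
      obtain ⟨β, rfl⟩ : ∃ β, α = β + 1 := ⟨α - 1, by ring⟩
      -- Excluding α = 0 is what keeps β strictly above -1, where the weight is integrable.
      have hβ0 : β ≠ -1 := fun h => h2 0 (by simp [h])
      have hβ1 : -1 < β := lt_of_le_of_ne (by linarith) hβ0.symm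
      have hβ2 : ∀ k : ℕ, β ≠ k := fun k h => h2 (k + 1) (by simp [h])
      push_cast at h3
      have hβ := ih β hβ1 hβ2 (by linarith)
      have hlin : EqOn (weight β) (fun t => (t - x) * weight β t / (t - x))
          (Ioi 0 \ {x}) := by
        intro t ht
        have : t - x ≠ 0 := sub_ne_zero.2 ht.2
        simp only
        field_simp
      have hae : weight β =ᵐ[volume.restrict (Ioi 0)]
          fun t => (t - x) * weight β t / (t - x) := by
        filter_upwards [ae_restrict_mem measurableSet_Ioi,
          ae_restrict_of_ae (Measure.ae_ne volume x)] with t h1 h2 using hlin ⟨h1, h2⟩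
      have hpv := hasPV_of_integrableOn hx ((integrableOn_weight hβ1).congr hae)
      rw [← integral_congr_ae hae, integral_weight hβ1] at hpv
      rw [pi_mul_Q_zero_add_one hβ2 (by linarith) hx]
      refine ((hβ.const_mul x).add hpv).congr hx fun t ht => ?_
      have := weight_add_natCast β 1 ht
      simp only [Nat.cast_one, pow_one] at this
      rw [this]
      ring
  obtain ⟨m, hm⟩ := exists_nat_gt α
  exact key m α hα hα' hm

/-! ### Algebra of the Laguerre polynomials -/

open Polynomial (X C)

lemma coeff_laguerre_add (α : ℝ) (k j : ℕ) :
    (laguerre α (k + j)).coeff k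
      = (-1 : ℝ) ^ k * (ascPochhammer ℝ j).eval (α + k + 1) / (j.factorial * k.factorial : ℝ) := by
  simp only [laguerre, Polynomial.finsetSum_coeff, Polynomial.coeff_monomial]
  rw [Finset.sum_ite_eq' (Finset.range (k + j + 1)) k, if_pos (by simp)]
  simp

lemma coeff_laguerre_of_lt (α : ℝ) {n k : ℕ} (h : n < k) : (laguerre α n).coeff k = 0 := by
  simp only [laguerre, Polynomial.finsetSum_coeff, Polynomial.coeff_monomial]
  rw [Finset.sum_ite_eq' (Finset.range (n + 1)) k, if_neg (by simp; omega)]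

lemma coeff_laguerre_self (α : ℝ) (n : ℕ) :
    (laguerre α n).coeff n = (-1 : ℝ) ^ n / n.factorial := by
  have := coeff_laguerre_add α n 0
  simpa using this

lemma natDegree_laguerre (α : ℝ) (n : ℕ) : (laguerre α n).natDegree = n := by
  refine le_antisymm (Polynomial.natDegree_le_iff_coeff_eq_zero.2 fun k hk =>
    coeff_laguerre_of_lt α hk) (Polynomial.le_natDegree_of_ne_zero ?_)
  rw [coeff_laguerre_self]
  positivity

lemma laguerre_ne_zero (α : ℝ) (n : ℕ) : laguerre α n ≠ 0 := by
  intro h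
  have := coeff_laguerre_self α n
  rw [h, Polynomial.coeff_zero] at this
  have h2 : (-1 : ℝ) ^ n / n.factorial ≠ 0 := by positivity
  exact h2 this.symm

/-- Together with `coeff_laguerre_succ_right` this gives the coefficient ratios in n and in k.
Cleared of denominators they hold for all indices, so polynomial identities can be checked
coefficientwise. -/
lemma coeff_laguerre_succ_left (α : ℝ) (n k : ℕ) :
    ((n : ℝ) + 1 - k) * (laguerre α (n + 1)).coeff k = (n + 1 + α) * (laguerre α n).coeff k := by
  rcases lt_trichotomy k (n + 1) with h | rfl | h
  · obtain ⟨j, rfl⟩ := Nat.exists_eq_add_of_le (Nat.lt_succ_iff.1 h)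
    rw [add_assoc, coeff_laguerre_add, coeff_laguerre_add, ascPochhammer_succ_eval,
      Nat.factorial_succ]
    have h1 : (k.factorial : ℝ) ≠ 0 := by positivity
    have h2 : (j.factorial : ℝ) ≠ 0 := by positivity
    push_cast
    field_simp
    ring
  · rw [coeff_laguerre_of_lt α (Nat.lt_succ_self n)]
    push_cast
    ring
  · rw [coeff_laguerre_of_lt α h, coeff_laguerre_of_lt α (by omega)]
    ring

lemma ascPochhammer_succ_eval_left (a : ℝ) (j : ℕ) :
    (ascPochhammer ℝ (j + 1)).eval a = a * (ascPochhammer ℝ j).eval (a + 1) := by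
  rw [ascPochhammer_succ_left]; simp

lemma coeff_laguerre_succ_right (α : ℝ) (n k : ℕ) :
    ((k : ℝ) + 1) * (α + k + 1) * (laguerre α n).coeff (k + 1)
      = -((n : ℝ) - k) * (laguerre α n).coeff k := by
  rcases lt_trichotomy k n with h | rfl | h
  · obtain ⟨j, rfl⟩ := Nat.exists_eq_add_of_le h
    rw [show k.succ + j = k + 1 + j from rfl, coeff_laguerre_add,
      show k + 1 + j = k + (j + 1) by ring, coeff_laguerre_add, ascPochhammer_succ_eval_left,
      Nat.factorial_succ, Nat.factorial_succ]
    have h1 : (k.factorial : ℝ) ≠ 0 := by positivity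
    have h2 : (j.factorial : ℝ) ≠ 0 := by positivity
    push_cast
    rw [show α + ((k : ℝ) + 1) + 1 = α + k + 1 + 1 by ring]
    field_simp
    ring
  · rw [coeff_laguerre_of_lt α (Nat.lt_succ_self k)]
    ring
  · rw [coeff_laguerre_of_lt α h, coeff_laguerre_of_lt α (by omega)]
    ring

lemma X_mul_derivative_laguerre (α : ℝ) (n : ℕ) :
    X * (laguerre α (n + 1)).derivative
      = C ((n : ℝ) + 1) * laguerre α (n + 1) - C ((n : ℝ) + 1 + α) * laguerre α n := by
  ext k
  have h := coeff_laguerre_succ_left α n k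
  rcases k with _ | k
  · simp only [Polynomial.coeff_sub, Polynomial.coeff_C_mul, Polynomial.coeff_X_mul_zero]
    push_cast at h
    linarith
  · simp only [Polynomial.coeff_sub, Polynomial.coeff_C_mul, Polynomial.coeff_X_mul,
      Polynomial.coeff_derivative]
    push_cast at h
    linarith

lemma laguerre_three_term (α : ℝ) (n : ℕ) :
    C ((n : ℝ) + 2) * laguerre α (n + 2)
      = (C (2 * (n : ℝ) + 3 + α) - X) * laguerre α (n + 1) - C ((n : ℝ) + 1 + α) * laguerre α n := by
  ext k
  rw [sub_mul]
  have h1 := coeff_laguerre_succ_left α (n + 1) k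
  have h2 := coeff_laguerre_succ_left α n k
  rcases k with _ | k
  · simp only [Polynomial.coeff_sub, Polynomial.coeff_C_mul, Polynomial.coeff_X_mul_zero]
    push_cast at h1 h2
    linear_combination h1 - h2
  · simp only [Polynomial.coeff_sub, Polynomial.coeff_C_mul, Polynomial.coeff_X_mul]
    have h3 := coeff_laguerre_succ_right α (n + 1) k
    push_cast at h1 h2 h3
    -- Here the factor n + 1 - k to be cancelled vanishes; the leading coefficients are compared
    -- directly.
    by_cases hk : k = n + 1
    · subst hk
      rw [coeff_laguerre_self, coeff_laguerre_self, coeff_laguerre_of_lt α (by omega),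
        coeff_laguerre_of_lt α (by omega)]
      rw [Nat.factorial_succ (n + 1), pow_succ]
      have h4 : ((n + 1).factorial : ℝ) ≠ 0 := by positivity
      push_cast
      field_simp
      ring
    · have hne : (n : ℝ) + 1 - k ≠ 0 := by
        rw [sub_ne_zero]
        exact_mod_cast Ne.symm hk
      refine mul_left_cancel₀ hne ?_
      linear_combination (n + 2) * h1 - (n + 1 - k) * h2 + h3

/-- One step of Rodrigues' formula. -/
lemma succ_mul_laguerre_succ (α : ℝ) (n : ℕ) :
    C ((n : ℝ) + 1) * laguerre α (n + 1)
      = X * (laguerre (α + 1) n).derivative + (C (α + 1) - X) * laguerre (α + 1) n := by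
  ext k
  rw [sub_mul]
  rcases k with _ | k
  · simp only [Polynomial.coeff_sub, Polynomial.coeff_add, Polynomial.coeff_C_mul,
      Polynomial.coeff_X_mul_zero]
    have h1 := coeff_laguerre_add α 0 (n + 1)
    have h2 := coeff_laguerre_add (α + 1) 0 n
    rw [zero_add] at h1 h2
    rw [h1, h2, ascPochhammer_succ_eval_left, Nat.factorial_succ]
    have h3 : (n.factorial : ℝ) ≠ 0 := by positivity
    push_cast
    rw [show α + 0 + 1 + 1 = α + 1 + 0 + 1 by ring]
    field_simp
    ring
  · simp only [Polynomial.coeff_sub, Polynomial.coeff_add, Polynomial.coeff_C_mul,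
      Polynomial.coeff_X_mul, Polynomial.coeff_derivative]
    rcases lt_trichotomy k n with h | rfl | h
    · obtain ⟨j, rfl⟩ := Nat.exists_eq_add_of_le h
      have e1 := coeff_laguerre_add α (k + 1) (j + 1)
      have e2 := coeff_laguerre_add (α + 1) (k + 1) j
      have e3 := coeff_laguerre_add (α + 1) k (j + 1)
      rw [show k.succ + j + 1 = k + 1 + (j + 1) by ring_nf; omega, e1,
        show k.succ + j = k + 1 + j from rfl, e2, show k + 1 + j = k + (j + 1) by ring, e3]
      push_cast
      rw [show α + ((k : ℝ) + 1) + 1 = α + 1 + k + 1 by ring,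
        show α + 1 + ((k : ℝ) + 1) + 1 = α + 1 + k + 1 + 1 by ring,
        ascPochhammer_succ_eval_left, Nat.factorial_succ, Nat.factorial_succ]
      have h1 : (k.factorial : ℝ) ≠ 0 := by positivity
      have h2 : (j.factorial : ℝ) ≠ 0 := by positivity
      push_cast
      field_simp
      ring
    · rw [coeff_laguerre_of_lt (α + 1) (Nat.lt_succ_self k), coeff_laguerre_self,
        coeff_laguerre_self, Nat.factorial_succ, pow_succ]
      have h1 : (k.factorial : ℝ) ≠ 0 := by positivity
      push_cast
      field_simp
      ring
    · rw [coeff_laguerre_of_lt _ h, coeff_laguerre_of_lt _ (by omega),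
        coeff_laguerre_of_lt _ (by omega)]
      ring

/-! ### Orthogonality -/

/-- The integral of a polynomial against the Laguerre weight. -/
def weightedIntegral (α : ℝ) (p : Polynomial ℝ) : ℝ := ∫ t in Ioi 0, p.eval t * weight α t

lemma integrableOn_eval_mul_weight {α : ℝ} (hα : -1 < α) (p : Polynomial ℝ) :
    IntegrableOn (fun t => p.eval t * weight α t) (Ioi 0) := by
  induction p using Polynomial.induction_on' with
  | add p q hp hq =>
    simp only [Polynomial.eval_add, add_mul]
    exact hp.add hq
  | monomial k a =>
    have hk : -1 < α + k := by have := k.cast_nonneg (α := ℝ); linarith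
    have h : IntegrableOn (fun t => a * weight (α + k) t) (Ioi 0) :=
      (integrableOn_weight hk).const_mul a
    refine h.congr_fun (fun t ht => ?_) measurableSet_Ioi
    simp only [Polynomial.eval_monomial]
    rw [weight_add_natCast α k ht, mul_assoc]

section

variable {α : ℝ} (hα : -1 < α)
include hα

lemma weightedIntegral_add (p q : Polynomial ℝ) :
    weightedIntegral α (p + q) = weightedIntegral α p + weightedIntegral α q := by
  simp only [weightedIntegral, Polynomial.eval_add, add_mul]
  exact integral_add (integrableOn_eval_mul_weight hα p) (integrableOn_eval_mul_weight hα q)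

lemma weightedIntegral_monomial (k : ℕ) (a : ℝ) :
    weightedIntegral α (Polynomial.monomial k a) = a * Real.Gamma (α + k + 1) := by
  have hk : -1 < α + k := by have := k.cast_nonneg (α := ℝ); linarith
  rw [← integral_weight hk, weightedIntegral, ← integral_const_mul]
  refine setIntegral_congr_fun measurableSet_Ioi fun t ht => ?_
  simp only [Polynomial.eval_monomial]
  rw [weight_add_natCast α k ht, mul_assoc]

end

lemma weightedIntegral_C_mul (α c : ℝ) (p : Polynomial ℝ) :
    weightedIntegral α (C c * p) = c * weightedIntegral α p := by
  simp only [weightedIntegral, Polynomial.eval_mul, Polynomial.eval_C, mul_assoc]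
  exact integral_const_mul _ _

lemma weightedIntegral_X_mul (α : ℝ) (p : Polynomial ℝ) :
    weightedIntegral α (X * p) = weightedIntegral (α + 1) p := by
  refine setIntegral_congr_fun measurableSet_Ioi fun t ht => ?_
  have := weight_add_natCast α 1 ht
  simp only [Nat.cast_one, pow_one] at this
  simp only [Polynomial.eval_mul, Polynomial.eval_X, this]
  ring

lemma weightedIntegral_neg (α : ℝ) (p : Polynomial ℝ) :
    weightedIntegral α (-p) = -weightedIntegral α p := by
  have := weightedIntegral_C_mul α (-1) p
  simpa using this

/-- Integration by parts against the Laguerre weight. -/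
lemma weightedIntegral_parts {α : ℝ} (hα : -1 < α) (p : Polynomial ℝ) :
    weightedIntegral α (X * p.derivative + (C (α + 1) - X) * p) = 0 := by
  induction p using Polynomial.induction_on' with
  | add p q hp hq =>
    rw [Polynomial.derivative_add, show X * (p.derivative + q.derivative) + (C (α + 1) - X) * (p + q)
      = (X * p.derivative + (C (α + 1) - X) * p) + (X * q.derivative + (C (α + 1) - X) * q) by ring,
      weightedIntegral_add hα, hp, hq, add_zero]
  | monomial k a =>
    have e : X * (Polynomial.monomial k a).derivative + (C (α + 1) - X) * Polynomial.monomial k a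
        = C (α + k + 1) * Polynomial.monomial k a + -(X * Polynomial.monomial k a) := by
      rw [Polynomial.derivative_monomial]
      rcases k with _ | k
      · simp
        ring
      · simp only [Nat.add_sub_cancel, Polynomial.X_mul_monomial, sub_mul,
          Polynomial.C_mul_monomial]
        rw [← sub_eq_add_neg, ← add_sub_assoc, ← map_add]
        congr 2
        push_cast
        ring
    have hk : α + k + 1 ≠ 0 := by have := k.cast_nonneg (α := ℝ); linarith
    rw [e, weightedIntegral_add hα, weightedIntegral_neg, weightedIntegral_X_mul,
      weightedIntegral_C_mul, weightedIntegral_monomial hα,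
      weightedIntegral_monomial (by linarith), show α + 1 + k + 1 = α + k + 1 + 1 by ring,
      Real.Gamma_add_one hk]
    ring

/-- Orthogonality of the Laguerre polynomials, together with the norming integral. -/
lemma weightedIntegral_laguerre_mul {α : ℝ} (hα : -1 < α) (n : ℕ) (q : Polynomial ℝ)
    (hq : q.natDegree ≤ n) :
    weightedIntegral α (laguerre α n * q) = (-1) ^ n * Real.Gamma (α + n + 1) * q.coeff n := by
  induction n generalizing α q with
  | zero =>
    have hl : laguerre α 0 = 1 := by simp [laguerre]
    rw [Polynomial.eq_C_of_natDegree_le_zero hq, hl, one_mul, ← Polynomial.monomial_zero_left,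
      weightedIntegral_monomial hα]
    simp
    ring
  | succ n ih =>
    have hd : q.derivative.natDegree ≤ n :=
      (Polynomial.natDegree_derivative_le q).trans (by omega)
    -- The Rodrigues step and integration by parts trade (n + 1, α, q) for (n, α + 1, q'), which is
    -- why the induction generalizes over α.
    have h1 := ih (α := α + 1) (by linarith) q.derivative hd
    rw [← weightedIntegral_X_mul] at h1
    have h2 := weightedIntegral_parts hα (laguerre (α + 1) n * q)
    rw [Polynomial.derivative_mul, show X * ((laguerre (α + 1) n).derivative * q
        + laguerre (α + 1) n * q.derivative) + (C (α + 1) - X) * (laguerre (α + 1) n * q)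
      = (X * (laguerre (α + 1) n).derivative + (C (α + 1) - X) * laguerre (α + 1) n) * q
        + X * (laguerre (α + 1) n * q.derivative) by ring, ← succ_mul_laguerre_succ,
      weightedIntegral_add hα, h1, mul_assoc, weightedIntegral_C_mul,
      Polynomial.coeff_derivative] at h2
    have h3 : (n : ℝ) + 1 ≠ 0 := by positivity
    refine mul_left_cancel₀ h3 ?_
    push_cast
    rw [show α + ((n : ℝ) + 1) + 1 = α + 1 + n + 1 by ring, pow_succ]
    linear_combination h2

lemma weightedIntegral_laguerre_mul_of_lt {α : ℝ} (hα : -1 < α) {n : ℕ} {q : Polynomial ℝ}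
    (hq : q.natDegree < n) : weightedIntegral α (laguerre α n * q) = 0 := by
  rw [weightedIntegral_laguerre_mul hα n q hq.le, Polynomial.coeff_eq_zero_of_natDegree_lt hq,
    mul_zero]

/-! ### Recurrences for `Q` and the Cauchy transform of the Laguerre polynomials -/

lemma kummer_contiguous {c : ℝ} (hc : ∀ k : ℕ, c + k ≠ 0) (a x : ℝ) :
    (c - a) * kummer (a - 1) c x + (2 * a - c + x) * kummer a c x - a * kummer (a + 1) c x = 0 := by
  have h1 := ((summable_kummer (a := a - 1) hc x).hasSum).mul_left (c - a)
  have h2 := ((summable_kummer (a := a) hc x).hasSum).mul_left (2 * a - c)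
  have h3 := ((summable_kummer (a := a + 1) hc x).hasSum).mul_left a
  have h4 := ((summable_kummer (a := a) hc x).hasSum).mul_left (-x)
  have h5 := (h1.add h2).sub h3
  rw [← hasSum_nat_add_iff' 1] at h5
  have h6 := h4.unique (hasSum_congr_terms h5 fun k => ?_)
  · simp only [Finset.range_one, Finset.sum_singleton, ascPochhammer_zero, Polynomial.eval_one,
      pow_zero, Nat.factorial_zero, Nat.cast_one, mul_one, div_one] at h6
    unfold kummer
    linear_combination -h6
  · have e1 : (ascPochhammer ℝ (k + 1)).eval (a - 1) = (a - 1) * (ascPochhammer ℝ k).eval a := by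
      rw [ascPochhammer_succ_eval_left, sub_add_cancel]
    have e2 : a * (ascPochhammer ℝ (k + 1)).eval (a + 1)
        = (ascPochhammer ℝ k).eval a * (a + k) * (a + k + 1) := by
      rw [← ascPochhammer_succ_eval_left, ascPochhammer_succ_eval, ascPochhammer_succ_eval]
      push_cast
      ring
    have e3 : a * ((ascPochhammer ℝ (k + 1)).eval (a + 1) * x ^ (k + 1)
          / ((ascPochhammer ℝ (k + 1)).eval c * (k + 1).factorial))
        = (ascPochhammer ℝ k).eval a * (a + k) * (a + k + 1) * x ^ (k + 1)
          / ((ascPochhammer ℝ (k + 1)).eval c * (k + 1).factorial) := by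
      rw [← e2]; ring
    rw [e3, e1, ascPochhammer_succ_eval, ascPochhammer_succ_eval, Nat.factorial_succ, pow_succ]
    have g1 := hc k
    have g2 := ascPochhammer_eval_ne_zero hc k
    have g3 : (k.factorial : ℝ) ≠ 0 := by positivity
    have g4 : (k : ℝ) + 1 ≠ 0 := by positivity
    push_cast
    field_simp
    ring

lemma kummer_self {c : ℝ} (hc : ∀ k : ℕ, c + k ≠ 0) (x : ℝ) : kummer c c x = Real.exp x := by
  rw [Real.exp_eq_exp_ℝ]
  refine ((summable_kummer hc x).hasSum).unique
    (hasSum_congr_terms (NormedSpace.expSeries_div_hasSum_exp x) fun k => ?_)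
  rw [mul_div_mul_left _ _ (ascPochhammer_eval_ne_zero hc k)]

lemma laguerre_one (α : ℝ) : laguerre α 1 = C (1 + α) - X := by
  ext k
  rcases k with _ | _ | k
  · have := coeff_laguerre_add α 0 1
    rw [zero_add] at this
    rw [this]
    simp [Polynomial.coeff_X, add_comm]
  · rw [zero_add, coeff_laguerre_self]
    simp [Polynomial.coeff_one]
  · rw [coeff_laguerre_of_lt α (by omega)]
    simp [Polynomial.coeff_X, Polynomial.coeff_one]

section

variable {α : ℝ} (hα' : ∀ k : ℕ, α ≠ k)
include hα'

lemma one_sub_add_natCast_ne_zero (k : ℕ) : 1 - α + k ≠ 0 := fun h =>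
  hα' (k + 1) (by push_cast; linarith)

/-- Both summands of `Q` obey the Laguerre recurrence: the Kummer part by the contiguous relation at
a = -(n+1) - α, c = 1 - α, where c - a = n + 2. -/
lemma Q_three_term (n : ℕ) (x : ℝ) :
    ((n : ℝ) + 2) * Q α (n + 2) x
      = (2 * (n : ℝ) + 3 + α - x) * Q α (n + 1) x - (n + 1 + α) * Q α n x := by
  have h := kummer_contiguous (one_sub_add_natCast_ne_zero hα') (-((n : ℝ) + 1) - α) x
  have hl := congrArg (Polynomial.eval x) (laguerre_three_term α n)
  simp only [Polynomial.eval_mul, Polynomial.eval_sub, Polynomial.eval_C, Polynomial.eval_X] at hl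
  unfold Q
  push_cast
  rw [show -((n : ℝ) + 1) - α - 1 = -((n : ℝ) + 2) - α by ring,
    show -((n : ℝ) + 1) - α + 1 = -(n : ℝ) - α by ring] at h
  linear_combination Real.Gamma α / Real.pi * Real.exp (-x) * h
    - Real.cot (Real.pi * α) * x ^ α * Real.exp (-x) * hl

/-- In the contiguous relation at a = -α the third function is Φ(1-α, 1-α; x) = e^x, which produces
the inhomogeneous term Γ(α+1). -/
lemma Q_one (x : ℝ) :
    Real.pi * Q α 1 x = (1 + α - x) * (Real.pi * Q α 0 x) - Real.Gamma (α + 1) := by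
  have hα0 : α ≠ 0 := by simpa using hα' 0
  have hc := one_sub_add_natCast_ne_zero hα'
  have h := kummer_contiguous hc (-α) x
  have hl0 : laguerre α 0 = 1 := by simp [laguerre]
  have he : Real.exp (-x) * Real.exp x = 1 := by rw [← Real.exp_add]; simp
  rw [show -α + 1 = 1 - α by ring, kummer_self hc] at h
  rw [Real.Gamma_add_one hα0]
  unfold Q
  rw [laguerre_one α, hl0]
  simp only [Polynomial.eval_sub, Polynomial.eval_C, Polynomial.eval_X, Polynomial.eval_one,
    Nat.cast_one, Nat.cast_zero, neg_zero, zero_sub]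
  rw [show -1 - α = -α - 1 by ring]
  have := Real.pi_ne_zero
  field_simp
  linear_combination Real.Gamma α * Real.exp (-x) * h - Real.Gamma α * α * he

end

lemma hasPV_sub_mul {α x : ℝ} (hα : -1 < α) (hx : 0 < x) (q : Polynomial ℝ) :
    HasPV (fun t => ((X - C x) * q).eval t * weight α t) x (weightedIntegral α q) := by
  have hae : (fun t => q.eval t * weight α t) =ᵐ[volume.restrict (Ioi 0)]
      fun t => ((X - C x) * q).eval t * weight α t / (t - x) := by
    filter_upwards [ae_restrict_of_ae (Measure.ae_ne volume x)] with t ht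
    have : t - x ≠ 0 := sub_ne_zero.2 ht
    simp only [Polynomial.eval_mul, Polynomial.eval_sub, Polynomial.eval_X, Polynomial.eval_C]
    field_simp
  have h := hasPV_of_integrableOn hx ((integrableOn_eval_mul_weight hα q).congr hae)
  rwa [← integral_congr_ae hae] at h

/-- The Cauchy transform of `L_n^α` is `Q_n^α`. -/
lemma hasPV_laguerre {α x : ℝ} (hα : -1 < α) (hα' : ∀ k : ℕ, α ≠ k) (hx : 0 < x) (n : ℕ) :
    HasPV (fun t => (laguerre α n).eval t * weight α t) x (Real.pi * Q α n x) := by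
  have hl0 : laguerre α 0 = 1 := by simp [laguerre]
  have h0 := hasPV_weight hα hα' hx
  induction n using Nat.twoStepInduction with
  | zero => simpa [hl0] using h0
  | one =>
    have h1 := hasPV_sub_mul hα hx (Polynomial.monomial 0 1)
    rw [weightedIntegral_monomial hα] at h1
    have h2 := (h0.const_mul (1 + α - x)).add (h1.const_mul (-1))
    have e : (1 + α - x) * (Real.pi * Q α 0 x) + -1 * (1 * Real.Gamma (α + (0 : ℕ) + 1))
        = Real.pi * Q α 1 x := by
      rw [Q_one hα']; simp; ring
    rw [e] at h2
    refine h2.congr hx fun t _ => ?_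
    rw [laguerre_one α]
    simp
    ring
  | more n ih0 ih1 =>
    have h1 := hasPV_sub_mul hα hx (laguerre α (n + 1))
    -- Replacing the factor t by x costs ∫ L_{n+1} w, which is 0 by orthogonality to 1. Only the
    -- step from L_0 to L_1 leaves a gamma term.
    have hz := weightedIntegral_laguerre_mul_of_lt hα (n := n + 1) (q := 1) (by simp)
    rw [mul_one] at hz
    rw [hz] at h1
    have hn : (n : ℝ) + 2 ≠ 0 := by positivity
    have h2 := (((ih1.const_mul (2 * (n : ℝ) + 3 + α - x)).add (h1.const_mul (-1))).add
      (ih0.const_mul (-(n + 1 + α)))).const_mul ((n : ℝ) + 2)⁻¹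
    have e : ((n : ℝ) + 2)⁻¹ * ((2 * (n : ℝ) + 3 + α - x) * (Real.pi * Q α (n + 1) x) + -1 * 0
        + -(n + 1 + α) * (Real.pi * Q α n x)) = Real.pi * Q α (n + 2) x := by
      rw [inv_mul_eq_iff_eq_mul₀ hn]
      linear_combination -Real.pi * Q_three_term hα' n x
    rw [e] at h2
    refine h2.congr hx fun t _ => ?_
    have hl := congrArg (Polynomial.eval t) (laguerre_three_term α n)
    simp only [Polynomial.eval_mul, Polynomial.eval_sub, Polynomial.eval_C,
      Polynomial.eval_X] at hl ⊢
    rw [inv_mul_eq_iff_eq_mul₀ hn]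
    linear_combination -weight α t * hl

/-! ### Zeros of the Laguerre polynomials -/

lemma weightedIntegral_pos {α : ℝ} (hα : -1 < α) {p : Polynomial ℝ} (hp : p ≠ 0)
    (h : ∀ t, 0 < t → 0 ≤ p.eval t) : 0 < weightedIntegral α p := by
  refine (setIntegral_pos_iff_support_of_nonneg_ae ?_ (integrableOn_eval_mul_weight hα p)).2 ?_
  · filter_upwards [ae_restrict_mem measurableSet_Ioi] with t ht
    exact mul_nonneg (h t ht) (weight_nonneg α (le_of_lt ht))
  · have hs : Ioi (0 : ℝ) \ (p.roots.toFinset : Set ℝ)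
        ⊆ (Function.support fun t => p.eval t * weight α t) ∩ Ioi 0 := by
      rintro t ⟨ht, hr⟩
      refine ⟨mul_ne_zero (fun h0 => hr ?_) (weight_pos α ht).ne', ht⟩
      simp [hp, h0]
    refine lt_of_lt_of_le ?_ (measure_mono hs)
    rw [measure_sdiff_null (Finset.measure_zero _ _)]
    simp

lemma constant_sign_of_roots_eq_zero {r : Polynomial ℝ} (hr0 : r ≠ 0) (hr : r.roots = 0) :
    (∀ t, 0 < r.eval t) ∨ ∀ t, r.eval t < 0 := by
  have hne : ∀ t, r.eval t ≠ 0 := fun t ht => by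
    have : t ∈ r.roots := (Polynomial.mem_roots hr0).2 ht
    simp [hr] at this
  by_contra hcon
  push Not at hcon
  obtain ⟨⟨a, ha⟩, b, hb⟩ := hcon
  obtain ⟨t, ht⟩ := mem_range_of_exists_le_of_exists_ge r.continuous ⟨a, ha⟩ ⟨b, hb⟩
  exact hne t ht

/-- A polynomial orthogonal to all polynomials of smaller degree has only simple positive
roots. -/
lemma card_positive_roots {α : ℝ} (hα : -1 < α) {p : Polynomial ℝ} (hp : p ≠ 0)
    (horth : ∀ q : Polynomial ℝ, q.natDegree < p.natDegree → weightedIntegral α (p * q) = 0) :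
    p.natDegree ≤ (p.roots.toFinset.filter (0 < ·)).card := by
  -- These are the positive roots at which p changes sign. If they were fewer than deg p, then p
  -- would be orthogonal to their product q, although p·q has constant sign on (0, ∞).
  set s := p.roots.toFinset.filter fun a => 0 < a ∧ Odd (p.roots.count a) with hs
  set q : Polynomial ℝ := ∏ a ∈ s, (X - C a) with hq
  have hqd : q.natDegree = s.card := Polynomial.natDegree_finsetProd_X_sub_C_eq_card s _
  have hq0 : q ≠ 0 := Finset.prod_ne_zero_iff.2 fun a _ => Polynomial.X_sub_C_ne_zero a
  have hle : s.card ≤ (p.roots.toFinset.filter (0 < ·)).card :=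
    Finset.card_le_card fun a ha => by
      simp only [hs, Finset.mem_filter] at ha ⊢
      exact ⟨ha.1, ha.2.1⟩
  refine le_trans ?_ hle
  by_contra hlt
  push Not at hlt
  have h0 := horth q (by rw [hqd]; exact hlt)
  obtain ⟨r, hr, -, hroots⟩ := Polynomial.exists_prod_multiset_X_sub_C_mul p
  have hr0 : r ≠ 0 := by rintro rfl; exact hp (by rw [← hr, mul_zero])
  have hpq0 : p * q ≠ 0 := mul_ne_zero hp hq0
  -- For t > 0 every root contributes an even power or a power of t - a with a ≤ 0; the rootless
  -- cofactor r has constant sign.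
  have hfac : ∀ t, 0 < t → ∃ c, 0 ≤ c ∧ (p * q).eval t = c * r.eval t := by
    intro t ht
    refine ⟨∏ a ∈ p.roots.toFinset, ((t - a) ^ p.roots.count a
      * if 0 < a ∧ Odd (p.roots.count a) then t - a else 1), ?_, ?_⟩
    · refine Finset.prod_nonneg fun a _ => ?_
      by_cases ha : 0 < a
      · by_cases ho : Odd (p.roots.count a)
        · rw [if_pos ⟨ha, ho⟩, ← pow_succ]
          exact (ho.add_one).pow_nonneg _
        · rw [if_neg (fun h => ho h.2), mul_one]
          exact (Nat.not_odd_iff_even.1 ho).pow_nonneg _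
      · rw [if_neg (fun h => ha h.1), mul_one]
        exact pow_nonneg (by linarith) _
    · conv_lhs => rw [← hr]
      rw [Polynomial.eval_mul, Polynomial.eval_mul, Finset.prod_multiset_map_count,
        Polynomial.eval_prod, hq, Polynomial.eval_prod, Finset.prod_mul_distrib, hs,
        Finset.prod_filter]
      simp only [Polynomial.eval_pow, Polynomial.eval_sub, Polynomial.eval_X, Polynomial.eval_C]
      ring
  rcases constant_sign_of_roots_eq_zero hr0 hroots with h | h
  · have := weightedIntegral_pos hα hpq0 fun t ht => by
      obtain ⟨c, hc, e⟩ := hfac t ht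
      rw [e]; exact mul_nonneg hc (h t).le
    exact this.ne' h0
  · have := weightedIntegral_pos hα (neg_ne_zero.2 hpq0) fun t ht => by
      obtain ⟨c, hc, e⟩ := hfac t ht
      rw [Polynomial.eval_neg, e, ← mul_neg]
      exact mul_nonneg hc (neg_nonneg.2 (h t).le)
    rw [weightedIntegral_neg, h0, neg_zero] at this
    exact lt_irrefl _ this

lemma nodes_spec {α : ℝ} (hα : -1 < α) (n : ℕ) :
    (nodes α n).card = n ∧ ∀ x ∈ nodes α n, 0 < x := by
  have h1 := card_positive_roots hα (laguerre_ne_zero α n) fun q hq => by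
    rw [natDegree_laguerre] at hq
    exact weightedIntegral_laguerre_mul_of_lt hα hq
  rw [natDegree_laguerre] at h1
  have h2 : (nodes α n).card ≤ n := by
    refine (Multiset.toFinset_card_le _).trans ((Polynomial.card_roots' _).trans ?_)
    rw [natDegree_laguerre]
  have h3 : (nodes α n).filter (0 < ·) = nodes α n :=
    Finset.eq_of_subset_of_card_le (Finset.filter_subset _ _) (h2.trans h1)
  refine ⟨le_antisymm h2 (h3 ▸ h1), fun x hx => ?_⟩
  rw [← h3] at hx
  exact (Finset.mem_filter.1 hx).2

lemma mem_nodes {α : ℝ} {n : ℕ} {a : ℝ} : a ∈ nodes α n ↔ (laguerre α n).eval a = 0 := by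
  simp [nodes, laguerre_ne_zero]

/-- By the three-term recurrence a common zero of two neighbours would descend to L_0 = 1. -/
lemma laguerre_eval_ne_zero_of_succ {α : ℝ} (hα : -1 < α) (n : ℕ) {a : ℝ}
    (h : (laguerre α (n + 1)).eval a = 0) : (laguerre α n).eval a ≠ 0 := by
  induction n with
  | zero => simp [laguerre]
  | succ n ih =>
    intro h0
    have hl := congrArg (Polynomial.eval a) (laguerre_three_term α n)
    simp only [Polynomial.eval_mul, Polynomial.eval_sub, Polynomial.eval_C, Polynomial.eval_X,
      h, h0, mul_zero, zero_sub] at hl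
    have hn : (n : ℝ) + 1 + α ≠ 0 := by have := n.cast_nonneg (α := ℝ); linarith
    exact ih h0 ((mul_eq_zero.1 (neg_eq_zero.1 hl.symm)).resolve_left hn)

/-! ### Interpolation at the nodes and Gauss quadrature -/

/-- The quotient `L_n^α / (X - a)`. -/
def nodeQuotient (α : ℝ) (n : ℕ) (a : ℝ) : Polynomial ℝ := laguerre α n /ₘ (X - C a)

lemma sub_mul_nodeQuotient {α : ℝ} {n : ℕ} {a : ℝ} (ha : a ∈ nodes α n) :
    (X - C a) * nodeQuotient α n a = laguerre α n :=
  Polynomial.mul_divByMonic_eq_iff_isRoot.2 (mem_nodes.1 ha)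

lemma natDegree_nodeQuotient (α : ℝ) (n : ℕ) (a : ℝ) :
    (nodeQuotient α n a).natDegree = n - 1 := by
  rw [nodeQuotient, Polynomial.natDegree_divByMonic _ (Polynomial.monic_X_sub_C a),
    natDegree_laguerre, Polynomial.natDegree_X_sub_C]

lemma nodeQuotient_eval_self {α : ℝ} {n : ℕ} {a : ℝ} (ha : a ∈ nodes α n) :
    (nodeQuotient α n a).eval a = (laguerre α n).derivative.eval a := by
  conv_rhs => rw [← sub_mul_nodeQuotient ha]
  simp [Polynomial.derivative_mul]

lemma nodeQuotient_eval_of_ne {α : ℝ} {n : ℕ} {a b : ℝ} (ha : a ∈ nodes α n)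
    (hb : b ∈ nodes α n) (hab : b ≠ a) : (nodeQuotient α n a).eval b = 0 := by
  have h := mem_nodes.1 hb
  rw [← sub_mul_nodeQuotient ha] at h
  simp only [Polynomial.eval_mul, Polynomial.eval_sub, Polynomial.eval_X, Polynomial.eval_C] at h
  exact (mul_eq_zero.1 h).resolve_left (sub_ne_zero.2 hab)

section

variable {α : ℝ} (hα : -1 < α)
include hα

/-- Evaluating the formula for X·L' at a node identifies γ with 1/L'(a), the Lagrange interpolation
factor. -/
lemma gammaCoeff_mul_derivative (n : ℕ) {a : ℝ} (ha : a ∈ nodes α (n + 1)) :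
    gammaCoeff α (n + 1) a * (laguerre α (n + 1)).derivative.eval a = 1 := by
  have hpos := (nodes_spec hα (n + 1)).2 a ha
  have h := mem_nodes.1 ha
  have h1 := laguerre_eval_ne_zero_of_succ hα n h
  have hl := congrArg (Polynomial.eval a) (X_mul_derivative_laguerre α n)
  simp only [Polynomial.eval_mul, Polynomial.eval_sub, Polynomial.eval_C, Polynomial.eval_X,
    h, mul_zero, zero_sub] at hl
  have hn : (n : ℝ) + 1 + α ≠ 0 := by have := n.cast_nonneg (α := ℝ); linarith
  unfold gammaCoeff
  rw [Nat.add_sub_cancel]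
  push_cast
  field_simp
  linear_combination -hl

/-- Lagrange interpolation at the nodes. -/
lemma eq_sum_nodeQuotient (n : ℕ) {r : Polynomial ℝ} (hr : r.natDegree ≤ n) :
    r = ∑ a ∈ nodes α (n + 1),
      C (gammaCoeff α (n + 1) a * r.eval a) * nodeQuotient α (n + 1) a := by
  refine Polynomial.eq_of_degrees_lt_of_eval_finset_eq (nodes α (n + 1)) ?_ ?_ ?_
  · rw [(nodes_spec hα (n + 1)).1]
    exact lt_of_le_of_lt (Polynomial.degree_le_of_natDegree_le hr) (by norm_cast; omega)
  · rw [(nodes_spec hα (n + 1)).1]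
    refine lt_of_le_of_lt (Polynomial.degree_sum_le _ _) ?_
    refine (Finset.sup_lt_iff (WithBot.bot_lt_coe _)).2 fun a _ => ?_
    refine lt_of_le_of_lt (Polynomial.degree_le_of_natDegree_le
      (Polynomial.natDegree_C_mul_le _ _)) ?_
    rw [natDegree_nodeQuotient]
    norm_cast
    omega
  · intro b hb
    rw [Polynomial.eval_finsetSum, Finset.sum_eq_single b]
    · rw [Polynomial.eval_mul, Polynomial.eval_C, nodeQuotient_eval_self hb]
      linear_combination -(r.eval b) * gammaCoeff_mul_derivative hα n hb
    · intro a ha hab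
      rw [Polynomial.eval_mul, nodeQuotient_eval_of_ne ha hb hab.symm, mul_zero]
    · exact fun h => absurd hb h

lemma weightedIntegral_sum (s : Finset ℝ) (f : ℝ → Polynomial ℝ) :
    weightedIntegral α (∑ a ∈ s, f a) = ∑ a ∈ s, weightedIntegral α (f a) := by
  classical
  induction s using Finset.induction_on with
  | empty => simp [weightedIntegral]
  | insert a s ha ih => rw [Finset.sum_insert ha, Finset.sum_insert ha, weightedIntegral_add hα, ih]

variable (hα' : ∀ k : ℕ, α ≠ k)
include hα'

/-- As (t - a) q_a = L, the integral of q_a against the weight is the Cauchy transform of L at the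
node a. -/
lemma weightedIntegral_nodeQuotient (n : ℕ) {a : ℝ} (ha : a ∈ nodes α n) :
    weightedIntegral α (nodeQuotient α n a) = Real.pi * Q α n a := by
  have hpos := (nodes_spec hα n).2 a ha
  have h := hasPV_sub_mul hα hpos (nodeQuotient α n a)
  rw [sub_mul_nodeQuotient ha] at h
  exact h.unique (hasPV_laguerre hα hα' hpos n)

/-- Divide f by the Laguerre polynomial: the quotient has degree at most n and integrates to 0 by
orthogonality, while the remainder is interpolated at the nodes. -/
lemma gauss_quadrature_aux (n : ℕ) {f : Polynomial ℝ} (hf : f.natDegree ≤ 2 * n + 1) :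
    weightedIntegral α f = ∑ a ∈ nodes α (n + 1),
      gammaCoeff α (n + 1) a * (Real.pi * Q α (n + 1) a) * f.eval a := by
  set p := laguerre α (n + 1)
  have hp0 : p ≠ 0 := laguerre_ne_zero α (n + 1)
  have hpd : p.natDegree = n + 1 := natDegree_laguerre α (n + 1)
  have hdiv := EuclideanDomain.div_add_mod f p
  have hs : (f / p).natDegree < n + 1 := by
    rw [Polynomial.div_def]
    refine lt_of_le_of_lt (Polynomial.natDegree_C_mul_le _ _) ?_
    rw [Polynomial.natDegree_divByMonic _ (Polynomial.monic_mul_leadingCoeff_inv hp0),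
      Polynomial.natDegree_mul_leadingCoeff_inv _ hp0, hpd]
    omega
  have hr : (f % p).natDegree ≤ n := by
    have := Polynomial.natDegree_mod_lt f (q := p) (by omega)
    omega
  have hI : weightedIntegral α f = weightedIntegral α (f % p) := by
    conv_lhs => rw [← hdiv]
    rw [weightedIntegral_add hα, weightedIntegral_laguerre_mul_of_lt hα hs, zero_add]
  have hev : ∀ a ∈ nodes α (n + 1), (f % p).eval a = f.eval a := fun a ha => by
    conv_rhs => rw [← hdiv]
    rw [Polynomial.eval_add, Polynomial.eval_mul, mem_nodes.1 ha, zero_mul, zero_add]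
  rw [hI, eq_sum_nodeQuotient hα n hr, weightedIntegral_sum hα]
  refine Finset.sum_congr rfl fun a ha => ?_
  rw [weightedIntegral_C_mul, weightedIntegral_nodeQuotient hα hα' _ ha, hev a ha]
  ring

/-- Apply the quadrature to L_n·q_a: only the node a contributes, and the exact integral is the
norming integral with the leading coefficient of q_a. Hence `Q` is nonzero at the nodes, and the
weights γπQ(a) are the Christoffel coefficients. -/
lemma pi_mul_Q_node (n : ℕ) {a : ℝ} (ha : a ∈ nodes α (n + 1)) :
    Real.pi * Q α (n + 1) a * ((n + 1).factorial * (laguerre α n).eval a)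
      = -Real.Gamma (α + n + 1) := by
  have hd : (nodeQuotient α (n + 1) a).natDegree = n := natDegree_nodeQuotient α (n + 1) a
  have h1 := weightedIntegral_laguerre_mul hα n (nodeQuotient α (n + 1) a) hd.le
  have hdeg : (laguerre α n * nodeQuotient α (n + 1) a).natDegree ≤ 2 * n + 1 := by
    refine Polynomial.natDegree_mul_le.trans ?_
    rw [natDegree_laguerre, hd]
    omega
  rw [gauss_quadrature_aux hα hα' n hdeg, Finset.sum_eq_single a] at h1
  · have hlc : (nodeQuotient α (n + 1) a).coeff n = (-1) ^ (n + 1) / ((n + 1).factorial : ℝ) := by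
      rw [← coeff_laguerre_self α (n + 1), ← sub_mul_nodeQuotient ha, sub_mul,
        Polynomial.coeff_sub, Polynomial.coeff_X_mul, Polynomial.coeff_C_mul,
        Polynomial.coeff_eq_zero_of_natDegree_lt (n := n + 1) (by omega)]
      ring
    rw [Polynomial.eval_mul, nodeQuotient_eval_self ha, hlc] at h1
    have h2 := gammaCoeff_mul_derivative hα n ha
    have h3 : ((n + 1).factorial : ℝ) ≠ 0 := by positivity
    have h4 : (-1 : ℝ) ^ n * (-1) ^ (n + 1) = -1 := by
      rw [pow_succ, ← mul_assoc, ← mul_pow]; simp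
    field_simp at h1
    linear_combination h1 - Real.pi * Q α (n + 1) a * (n + 1).factorial * (laguerre α n).eval a * h2
      + Real.Gamma (α + n + 1) * h4
  · intro b hb hba
    rw [Polynomial.eval_mul, nodeQuotient_eval_of_ne ha hb hba]
    ring
  · exact fun h => absurd ha h

lemma Q_node_ne_zero (n : ℕ) {a : ℝ} (ha : a ∈ nodes α (n + 1)) : Q α (n + 1) a ≠ 0 := by
  intro h
  have h1 := pi_mul_Q_node hα hα' n ha
  rw [h, mul_zero, zero_mul] at h1
  have h2 : 0 < Real.Gamma (α + n + 1) :=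
    Real.Gamma_pos_of_pos (by have := n.cast_nonneg (α := ℝ); linarith)
  linarith

lemma christoffel_eq (n : ℕ) {a : ℝ} (ha : a ∈ nodes α (n + 1)) :
    christoffel α (n + 1) a = gammaCoeff α (n + 1) a * (Real.pi * Q α (n + 1) a) := by
  have h1 := pi_mul_Q_node hα hα' n ha
  have h2 := laguerre_eval_ne_zero_of_succ hα n (mem_nodes.1 ha)
  have h3 : ((n + 1).factorial : ℝ) ≠ 0 := by positivity
  have hn : (n : ℝ) + 1 + α ≠ 0 := by have := n.cast_nonneg (α := ℝ); linarith
  unfold christoffel gammaCoeff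
  rw [Nat.add_sub_cancel]
  push_cast
  rw [show α + ((n : ℝ) + 1) = α + n + 1 by ring]
  field_simp
  linear_combination a * h1

lemma gauss_quadrature (n : ℕ) {f : Polynomial ℝ} (hf : f.natDegree ≤ 2 * n + 1) :
    weightedIntegral α f = ∑ a ∈ nodes α (n + 1), christoffel α (n + 1) a * f.eval a := by
  rw [gauss_quadrature_aux hα hα' n hf]
  exact Finset.sum_congr rfl fun a ha => by rw [christoffel_eq hα hα' n ha]

/-! ### The quadrature formula at a zero of `Q` -/

variable {ξ : ℝ} (hξ : 0 < ξ) {n : ℕ} (hQ : Q α (n + 1) ξ = 0)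
include hξ hQ

omit hξ in
lemma node_ne_of_Q_eq_zero {a : ℝ} (ha : a ∈ nodes α (n + 1)) : a ≠ ξ := by
  rintro rfl
  exact Q_node_ne_zero hα hα' n ha hQ

omit hξ in
lemma quadSum_eq_of_Q_eq_zero (f : ℝ → ℝ) :
    quadSum α (n + 1) f ξ = (1 / Real.pi) * ∑ a ∈ nodes α (n + 1),
      christoffel α (n + 1) a * f a / (a - ξ) := by
  rw [quadSum, Finset.mul_sum]
  refine Finset.sum_congr rfl fun a ha => ?_
  rw [christoffel_eq hα hα' n ha, hQ]
  have h1 : a - ξ ≠ 0 := sub_ne_zero.2 (node_ne_of_Q_eq_zero hα hα' hQ ha)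
  have h2 : ξ - a ≠ 0 := sub_ne_zero.2 (node_ne_of_Q_eq_zero hα hα' hQ ha).symm
  have h3 := Real.pi_ne_zero
  rw [show ξ - a = -(a - ξ) by ring]
  field_simp
  ring

/-- Since (ξ - a) q_a = L - (t - ξ) q_a and the transform of L vanishes at ξ, only -∫ q_a w remains.
-/
lemma hasPV_nodeQuotient {a : ℝ} (ha : a ∈ nodes α (n + 1)) :
    HasPV (fun t => (nodeQuotient α (n + 1) a).eval t * weight α t) ξ
      (Real.pi * Q α (n + 1) a / (a - ξ)) := by
  have h1 : ξ - a ≠ 0 := sub_ne_zero.2 (node_ne_of_Q_eq_zero hα hα' hQ ha).symm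
  have h2 : a - ξ ≠ 0 := sub_ne_zero.2 (node_ne_of_Q_eq_zero hα hα' hQ ha)
  have hL := hasPV_laguerre hα hα' hξ (n + 1)
  rw [hQ] at hL
  have hq := hasPV_sub_mul hα hξ (nodeQuotient α (n + 1) a)
  rw [weightedIntegral_nodeQuotient hα hα' _ ha] at hq
  have h := (hL.add (hq.const_mul (-1))).const_mul (ξ - a)⁻¹
  have e : (ξ - a)⁻¹ * (Real.pi * 0 + -1 * (Real.pi * Q α (n + 1) a))
      = Real.pi * Q α (n + 1) a / (a - ξ) := by
    rw [show ξ - a = -(a - ξ) by ring, inv_neg]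
    field_simp
    ring
  rw [e] at h
  refine h.congr hξ fun t _ => ?_
  rw [← sub_mul_nodeQuotient ha, inv_mul_eq_iff_eq_mul₀ h1]
  simp only [Polynomial.eval_mul, Polynomial.eval_sub, Polynomial.eval_X, Polynomial.eval_C]
  ring

omit hα hα' hQ in
lemma HasPV.finset_sum (s : Finset ℝ) {g : ℝ → ℝ → ℝ} {v : ℝ → ℝ}
    (h : ∀ a ∈ s, HasPV (g a) ξ (v a)) :
    HasPV (fun t => ∑ a ∈ s, g a t) ξ (∑ a ∈ s, v a) := by
  classical
  induction s using Finset.induction_on with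
  | empty =>
    have := (hasPV_indicator hξ).const_mul 0
    simp only [zero_mul] at this
    simpa using this
  | insert a s ha ih =>
    simp only [Finset.sum_insert ha]
    exact (h a (Finset.mem_insert_self a s)).add
      (ih fun b hb => h b (Finset.mem_insert_of_mem hb))

/-- Two evaluations of the transform of the weight at ξ: the closed form, and interpolation of the
constant 1 by the q_a. -/
lemma pi_mul_Q_zero_eq_sum :
    Real.pi * Q α 0 ξ = ∑ a ∈ nodes α (n + 1), christoffel α (n + 1) a / (a - ξ) := by
  have h1 := HasPV.finset_sum hξ (nodes α (n + 1)) fun a ha =>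
    (hasPV_nodeQuotient hα hα' hξ hQ ha).const_mul (gammaCoeff α (n + 1) a)
  have h2 : HasPV (weight α) ξ (∑ a ∈ nodes α (n + 1),
      gammaCoeff α (n + 1) a * (Real.pi * Q α (n + 1) a / (a - ξ))) := by
    refine h1.congr hξ fun t _ => ?_
    have h3 := congrArg (Polynomial.eval t)
      (eq_sum_nodeQuotient hα n (r := 1) (by simp))
    simp only [Polynomial.eval_one, Polynomial.eval_finsetSum, Polynomial.eval_mul,
      Polynomial.eval_C, mul_one] at h3
    simp only [← mul_assoc]
    rw [← Finset.sum_mul, ← h3, one_mul]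
  rw [(hasPV_weight hα hα' hξ).unique h2]
  refine Finset.sum_congr rfl fun a ha => ?_
  rw [christoffel_eq hα hα' n ha]
  ring

/-- At a zero of `Q_n^α` the quadrature formula is exact for polynomials of degree at most
`2n`. -/
lemma hasPV_polynomial {p : Polynomial ℝ} (hp : p.natDegree ≤ 2 * (n + 1)) :
    HasPV (fun t => p.eval t * weight α t) ξ
      (∑ a ∈ nodes α (n + 1), christoffel α (n + 1) a * p.eval a / (a - ξ)) := by
  -- Splitting off p(ξ) lowers the degree by one, to 2n + 1, just within reach of Gauss quadrature
  -- with n + 1 nodes.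
  set q := p /ₘ (X - C ξ) with hq
  have hpq : p = C (p.eval ξ) + (X - C ξ) * q := by
    rw [← Polynomial.modByMonic_X_sub_C_eq_C_eval p ξ]
    exact (Polynomial.modByMonic_add_div p (X - C ξ)).symm
  have hqd : q.natDegree ≤ 2 * n + 1 := by
    rw [hq, Polynomial.natDegree_divByMonic _ (Polynomial.monic_X_sub_C ξ),
      Polynomial.natDegree_X_sub_C]
    omega
  have h1 := ((hasPV_weight hα hα' hξ).const_mul (p.eval ξ)).add (hasPV_sub_mul hα hξ q)
  rw [pi_mul_Q_zero_eq_sum hα hα' hξ hQ, gauss_quadrature hα hα' n hqd, Finset.mul_sum,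
    ← Finset.sum_add_distrib] at h1
  have e : ∑ a ∈ nodes α (n + 1), (p.eval ξ * (christoffel α (n + 1) a / (a - ξ))
      + christoffel α (n + 1) a * q.eval a)
      = ∑ a ∈ nodes α (n + 1), christoffel α (n + 1) a * p.eval a / (a - ξ) := by
    refine Finset.sum_congr rfl fun a ha => ?_
    have h2 : a - ξ ≠ 0 := sub_ne_zero.2 (node_ne_of_Q_eq_zero hα hα' hQ ha)
    have h3 := congrArg (Polynomial.eval a) hpq
    simp only [Polynomial.eval_add, Polynomial.eval_mul, Polynomial.eval_sub, Polynomial.eval_X,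
      Polynomial.eval_C] at h3
    rw [h3]
    field_simp
  rw [e] at h1
  refine h1.congr hξ fun t _ => ?_
  have h3 := congrArg (Polynomial.eval t) hpq
  simp only [Polynomial.eval_add, Polynomial.eval_mul, Polynomial.eval_sub, Polynomial.eval_X,
    Polynomial.eval_C] at h3 ⊢
  rw [h3]
  ring

end

end LaguerreCauchy

end

open LaguerreCauchy in
theorem corollary6p2 (α : ℝ) (hα : -1 < α) (hα' : ∀ k : ℕ, α ≠ k)
    (n : ℕ) (hn : 1 ≤ n)
    (ξ : ℝ) (hξ : 0 < ξ) (hQ : LaguerreCauchy.Q α n ξ = 0) :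
    -- there are `n` nodes; they are positive and different from `ξ`
    (LaguerreCauchy.nodes α n).card = n ∧
    (∀ x ∈ LaguerreCauchy.nodes α n, 0 < x ∧ x ≠ ξ) ∧
    -- the form of the quadrature formula at `ξ`, and its remainder
    (∀ f : ℝ → ℝ, LaguerreCauchy.Admissible f →
      LaguerreCauchy.HasCauchyIntegral α f ξ (LaguerreCauchy.cauchyIntegral α f ξ) ∧
      LaguerreCauchy.cauchyIntegral α f ξ =
        (1 / Real.pi) * (∑ x ∈ LaguerreCauchy.nodes α n,
          LaguerreCauchy.christoffel α n x * f x / (x - ξ))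
          + LaguerreCauchy.remainder α n f ξ ∧
      ∀ M : Polynomial ℝ, M.natDegree ≤ n - 1 →
        LaguerreCauchy.HasCauchyIntegral α (fun t => f t - M.eval t) ξ
          (LaguerreCauchy.cauchyIntegral α (fun t => f t - M.eval t) ξ) ∧
        LaguerreCauchy.remainder α n f ξ =
          -(∑ x ∈ LaguerreCauchy.nodes α n,
            LaguerreCauchy.gammaCoeff α n x * (f x - M.eval x) / (ξ - x)
              * (LaguerreCauchy.Q α n ξ - LaguerreCauchy.Q α n x))
            + LaguerreCauchy.cauchyIntegral α (fun t => f t - M.eval t) ξ) ∧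
    -- exactness for polynomials of degree at most `2n`
    (∀ p : Polynomial ℝ, p.natDegree ≤ 2 * n →
      LaguerreCauchy.HasCauchyIntegral α (fun t => p.eval t) ξ
        ((1 / Real.pi) * (∑ x ∈ LaguerreCauchy.nodes α n,
          LaguerreCauchy.christoffel α n x * p.eval x / (x - ξ))) ∧
      LaguerreCauchy.remainder α n (fun t => p.eval t) ξ = 0) := by
  obtain ⟨m, rfl⟩ : ∃ m, n = m + 1 := ⟨n - 1, by omega⟩
  have hexact : ∀ p : Polynomial ℝ, p.natDegree ≤ 2 * (m + 1) →
      HasCauchyIntegral α (fun t => p.eval t) ξ (quadSum α (m + 1) (fun t => p.eval t) ξ) := by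
    intro p hp
    rw [quadSum_eq_of_Q_eq_zero hα hα' hQ]
    exact hasCauchyIntegral_of_hasPV (hasPV_polynomial hα hα' hξ hQ hp)
  refine ⟨(nodes_spec hα _).1, fun x hx => ⟨(nodes_spec hα _).2 x hx,
    node_ne_of_Q_eq_zero hα hα' hQ hx⟩, fun f hf => ?_, fun p hp => ⟨?_, ?_⟩⟩
  · obtain ⟨v, hv⟩ := hf.exists_hasCauchyIntegral hα hξ
    refine ⟨hv.self, ?_, fun M hM => ?_⟩
    · rw [← quadSum_eq_of_Q_eq_zero hα hα' hQ, remainder]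
      ring
    · have hM' := hexact M (by omega)
      have h1 := hasCauchyIntegral_of_hasPV (f := fun t => f t - M.eval t)
        ((hv.hasPV.add (hM'.hasPV.const_mul (-1))).congr hξ fun t _ => by ring)
      refine ⟨h1.self, ?_⟩
      rw [h1.cauchyIntegral_eq, remainder, hv.cauchyIntegral_eq]
      have h2 : (∑ x ∈ nodes α (m + 1), gammaCoeff α (m + 1) x * (f x - M.eval x) / (ξ - x)
          * (Q α (m + 1) ξ - Q α (m + 1) x))
          = quadSum α (m + 1) f ξ - quadSum α (m + 1) (fun t => M.eval t) ξ := by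
        rw [quadSum, quadSum, ← Finset.sum_sub_distrib]
        exact Finset.sum_congr rfl fun x _ => by ring
      have h3 := Real.pi_ne_zero
      rw [h2]
      field_simp
      ring
  · rw [← quadSum_eq_of_Q_eq_zero hα hα' hQ]
    exact hexact p hp
  · rw [remainder, (hexact p hp).cauchyIntegral_eq, sub_self]
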